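/- Let $T_1$ and $T_2$ be the trees on the vertex set $\{0,1,\dots,15\}$, both rooted at $0$, with edge sets $$E(T_1)=\{01,\,02,\,13,\,14,\,25,\,36,\,47,\,58,\,59,\,\{8,10\},\{9,11\},\{10,12\},\{11,13\},\{13,14\},\{13,15\}\},$$ $$E(T_2)=\{01,\,02,\,13,\,24,\,25,\,36,\,37,\,48,\,59,\,\{8,10\},\{9,11\},\{11,12\},\{11,13\},\{12,14\},\{13,15\}\},$$ where $ab$ abbreviates $\{a,b\}$ (McKay's rooted trees). For rooted trees $\tau$ and $\sigma$ let the coalescence $\tau\cdot\sigma$ be the tree obtained from their disjoint union by identifying the two roots. For a finite simple graph $\Gamma$ with vertex set $S$, let $$G(\Gamma)=\langle s\in S \mid s^2=1\ (s\in S),\ (ss')^2=1\ (\{s,s'\}\in E(\Gamma))\rangle$$ be the right-angled Coxeter group based on $\Gamma$; its geodesic growth series with respect to $S$ is $\sum_{m\ge 0} f(m)\,t^m$, where $f(m)$ is the number of words $w\in S^*$ of length $m$ that are geodesic, i.e. such that no shorter word over $S$ represents the same element of $G(\Gamma)$. Two finite graphs are co-spectral if their adjacency matrices have the same characteristic polynomial.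 Theorem. Let $n\ge 17$. There are rooted trees on $n-15$ vertices, and for every rooted tree $\tau$ on $n-15$ vertices, the graphs $\Gamma_1=\tau\cdot T_1$ and $\Gamma_2=\tau\cdot T_2$ are trees on $n$ vertices such that (1) $\Gamma_1$ and $\Gamma_2$ are not isomorphic, but they are co-spectral and their complements are co-spectral; and (2) the right-angled Coxeter groups $G(\Gamma_1)$ and $G(\Gamma_2)$ have equal geodesic growth series with respect to their standard generating sets. In other words, the two families $\{\tau\cdot T_1\}$ and $\{\tau\cdot T_2\}$ of trees on $n$ vertices, both indexed by the rooted trees $\tau$ on $n-15$ vertices, have these properties for each index $\tau$. -/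

import Mathlib

noncomputable section

namespace GeodesicGrowth

/-- The coalescence of the rooted graphs `(τ, r)` and `(σ, s)`: the disjoint union of `τ` and `σ`
with the roots `r` and `s` identified. The merged root is `Sum.inl r`; the vertices of `σ` other
than `s` are the `Sum.inr w`. -/
def coalescence {V W : Type*} (τ : SimpleGraph V) (r : V) (σ : SimpleGraph W) (s : W) :
    SimpleGraph (V ⊕ {w : W // w ≠ s}) where
  Adj
    | .inl a, .inl b => τ.Adj a b
    | .inl a, .inr w => a = r ∧ σ.Adj s w
    | .inr w, .inl a => a = r ∧ σ.Adj s w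
    | .inr w, .inr w' => σ.Adj w w'
  symm := ⟨by
    rintro (a | a) (b | b) h
    · exact SimpleGraph.Adj.symm h
    · exact h
    · exact h
    · exact SimpleGraph.Adj.symm h⟩
  loopless := ⟨by
    rintro (a | a) h
    · exact τ.irrefl h
    · exact σ.irrefl h⟩

/-- McKay's first tree, on 16 vertices, to be rooted at `0`. -/
def mckayT1 : SimpleGraph (Fin 16) :=
  SimpleGraph.fromEdgeSet
    {s(0, 1), s(0, 2), s(1, 3), s(1, 4), s(2, 5), s(3, 6), s(4, 7), s(5, 8), s(5, 9),
      s(8, 10), s(9, 11), s(10, 12), s(11, 13), s(13, 14), s(13, 15)}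

/-- McKay's second tree, on 16 vertices, to be rooted at `0`. -/
def mckayT2 : SimpleGraph (Fin 16) :=
  SimpleGraph.fromEdgeSet
    {s(0, 1), s(0, 2), s(1, 3), s(2, 4), s(2, 5), s(3, 6), s(3, 7), s(4, 8), s(5, 9),
      s(8, 10), s(9, 11), s(11, 12), s(11, 13), s(12, 14), s(13, 15)}

/-- The member `τ · T₁` of the first family. -/
abbrev familyOne {V : Type*} (τ : SimpleGraph V) (r : V) :
    SimpleGraph (V ⊕ {w : Fin 16 // w ≠ 0}) :=
  coalescence τ r mckayT1 0

/-- The member `τ · T₂` of the second family. -/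
abbrev familyTwo {V : Type*} (τ : SimpleGraph V) (r : V) :
    SimpleGraph (V ⊕ {w : Fin 16 // w ≠ 0}) :=
  coalescence τ r mckayT2 0

open Classical in
/-- Two finite graphs are co-spectral if their adjacency matrices have the same characteristic
polynomial. -/
def Cospectral {V W : Type*} [Fintype V] [Fintype W] (G : SimpleGraph V) (H : SimpleGraph W) :
    Prop :=
  (G.adjMatrix ℤ).charpoly = (H.adjMatrix ℤ).charpoly

open Classical in
/-- The Coxeter matrix of the right-angled Coxeter group based on `G`: the entry is `2` for adjacent
vertices and `0`, which stands for `∞` (no relation), for distinct non-adjacent ones. Its group is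
`⟨V | s² = 1, (s s')² = 1 for s adjacent to s'⟩`. -/
def racgMatrix {V : Type*} (G : SimpleGraph V) : CoxeterMatrix V where
  M := Matrix.of fun s t => if s = t then 1 else if G.Adj s t then 2 else 0
  isSymm := by
    ext s t
    simp [Matrix.transpose_apply, eq_comm, G.adj_comm]
  diagonal s := by simp
  off_diagonal s t h := by
    simp only [Matrix.of_apply, if_neg h]
    split_ifs <;> decide

/-- The right-angled Coxeter group based on `G`. -/
abbrev RACG {V : Type*} (G : SimpleGraph V) : Type _ := (racgMatrix G).Group

/-- The standard generators of the right-angled Coxeter group, indexed by the vertices. -/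
def racgSystem {V : Type*} (G : SimpleGraph V) : CoxeterSystem (racgMatrix G) (RACG G) :=
  (racgMatrix G).toCoxeterSystem

/-- A word over the standard generators is geodesic if its length is the word length of the group
element that it represents. -/
def IsGeodesic {V : Type*} (G : SimpleGraph V) (w : List V) : Prop :=
  (racgSystem G).length ((racgSystem G).wordProd w) = w.length

/-- The number of geodesic words of length `m` over the standard generators. -/
def geodesicGrowth {V : Type*} (G : SimpleGraph V) (m : ℕ) : ℕ :=
  {w : List V | w.length = m ∧ IsGeodesic G w}.ncard

/-- The geodesic growth series with respect to the standard generators. -/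
def geodesicGrowthSeries {V : Type*} (G : SimpleGraph V) : PowerSeries ℤ :=
  PowerSeries.mk fun m => (geodesicGrowth G m : ℤ)

end GeodesicGrowth

end

/-! Geodesics. A word is geodesic exactly when no factor `s u s` has `s` commuting with all of `u`
(`isGeodesic_iff_reduced`). For the hard direction the group acts on families of words indexed by
the non-adjacent pairs of vertices. A reduced word sends the empty family to its own projections,
and the coordinate at `{s, s}` bounds from below the number of letters `s` in any word for the same
element.

Growth. Let `F` count all reduced words and `C v` those that `v` cancels into. Splitting off the
first letter gives `F = 1 + t (n F - ∑ C v)`. In a triangle-free graph the series for pairs can be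
eliminated, which leaves a linear system for the `C v` (`cancelSeries_pencil`). With `u = (1 + t) /
t` its matrix is `u (u + 1) I - u D + A`, where `D` is the degree matrix, and its right-hand side is
constant and proportional to `F`. Hence `F` depends on the graph only through `n` and the sum of the
solution for right-hand side `1`.

For a coalescence, eliminate the non-root vertices of `σ`: all that remains of `σ` is its root
degree and three rational functions of `u`, a Schur complement (`HasResponse`). McKay's two trees
have the same ones, so either may replace the other without changing the series, whatever `τ` is.

Spectra. An integral multiple of an orthogonal matrix fixes the root and the all-one vector and
intertwines the adjacency matrices of the two trees. Extended by a scalar on `τ`, it intertwines the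
coalescences and, since it commutes with the all-one matrix, also their complements.

Non-isomorphism. The vertices satisfying `IsFork`, an isomorphism-invariant condition, are strictly
fewer in the first coalescence. -/

noncomputable section

namespace GeodesicGrowth

/-! ### Reduced words in right-angled Coxeter groups -/

section Words

variable {V : Type*} (G : SimpleGraph V)

/-- The letter `s` can be moved to the front of the word by commutations, so that multiplying by
`s` on the left shortens the word. -/
def Cancels (s : V) : List V → Prop
  | [] => False
  | a :: l => a = s ∨ G.Adj s a ∧ Cancels s l

/-- A word is reduced if it has no factor `s u s` with `s` adjacent to all letters of `u`. -/
def Reduced : List V → Prop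
  | [] => True
  | a :: l => ¬ Cancels G a l ∧ Reduced l

/-- The family of words indexed by the pairs of non-adjacent (possibly equal) vertices; a word over
`V` gives such a family by projecting it to each of the pairs. -/
abbrev PairWords : Type _ := {p : Sym2 V // p ∉ G.edgeSet} → List V

open Classical in
/-- The length of the longest prefix that is a power of the letter `s`. -/
def headRun (s : V) : List V → ℕ
  | [] => 0
  | a :: l => if a = s then headRun s l + 1 else 0

variable {G} in
/-- The largest power of `s` that is a common prefix of the words indexed by pairs containing `s`. -/
def commonRun (s : V) (f : PairWords G) : ℕ :=
  ⨅ p : {p : {p : Sym2 V // p ∉ G.edgeSet} // s ∈ p.1}, headRun s (f p.1)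

variable {G} in
open Classical in
/-- Left multiplication by `s`: remove a common leading `s` or add one, by the parity of the common
run. -/
def toggle (s : V) (f : PairWords G) : PairWords G := fun p =>
  if s ∈ p.1 then (if Odd (commonRun s f) then (f p).tail else s :: f p) else f p

lemma headRun_cons_self (s : V) (l : List V) : headRun s (s :: l) = headRun s l + 1 := by
  simp [headRun]

lemma headRun_pos {s : V} {l : List V} (h : 0 < headRun s l) : l = s :: l.tail := by
  cases l with
  | nil => simp [headRun] at h
  | cons a l =>
    by_cases ha : a = s
    · simp [ha]
    · simp [headRun, ha] at h

instance nonempty_pairs (s : V) : Nonempty {p : {p : Sym2 V // p ∉ G.edgeSet} // s ∈ p.1} :=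
  ⟨⟨⟨s(s, s), by simp⟩, by simp⟩⟩

variable {G}

lemma commonRun_le {s : V} (f : PairWords G) (p : {p : Sym2 V // p ∉ G.edgeSet}) (hp : s ∈ p.1) :
    commonRun s f ≤ headRun s (f p) :=
  ciInf_le' (fun p : {p : {p : Sym2 V // p ∉ G.edgeSet} // s ∈ p.1} => headRun s (f p.1)) ⟨p, hp⟩

lemma commonRun_eq_succ {s : V} {f g : PairWords G} (h : ∀ p, s ∈ p.1 → g p = s :: f p) :
    commonRun s g = commonRun s f + 1 := by
  apply le_antisymm
  · obtain ⟨⟨p, hp⟩, hf⟩ := ciInf_mem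
      (fun p : {p : {p : Sym2 V // p ∉ G.edgeSet} // s ∈ p.1} => headRun s (f p.1))
    have h1 := commonRun_le g p hp
    rw [h p hp, headRun_cons_self] at h1
    exact h1.trans (Nat.succ_le_succ hf.le)
  · refine le_ciInf fun p => ?_
    rw [h p.1 p.2, headRun_cons_self]
    exact Nat.succ_le_succ (commonRun_le f p.1 p.2)

lemma commonRun_congr {s : V} {f g : PairWords G} (h : ∀ p, s ∈ p.1 → g p = f p) :
    commonRun s g = commonRun s f := by
  unfold commonRun
  congr 1
  funext p
  rw [h p.1 p.2]

lemma toggle_of_mem_odd {s : V} {f : PairWords G} {p : {p : Sym2 V // p ∉ G.edgeSet}}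
    (hp : s ∈ p.1) (h : Odd (commonRun s f)) : f p = s :: toggle s f p := by
  rw [toggle, if_pos hp, if_pos h]
  exact headRun_pos (lt_of_lt_of_le h.pos (commonRun_le f p hp))

lemma toggle_of_mem_even {s : V} {f : PairWords G} {p : {p : Sym2 V // p ∉ G.edgeSet}}
    (hp : s ∈ p.1) (h : ¬ Odd (commonRun s f)) : toggle s f p = s :: f p := by
  rw [toggle, if_pos hp, if_neg h]

lemma toggle_of_notMem {s : V} {f : PairWords G} {p : {p : Sym2 V // p ∉ G.edgeSet}}
    (hp : s ∉ p.1) : toggle s f p = f p := by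
  rw [toggle, if_neg hp]

/-- Adding or removing a leading `s` changes the common run by one, so its parity flips and the
second toggle undoes the first. Testing parity rather than positivity makes this work for every
family, not only for projections of reduced words. -/
lemma toggle_toggle (s : V) (f : PairWords G) : toggle s (toggle s f) = f := by
  funext p
  by_cases hp : s ∈ p.1
  · by_cases h : Odd (commonRun s f)
    · have h1 := commonRun_eq_succ (fun p hp => toggle_of_mem_odd (p := p) hp h)
      rw [toggle_of_mem_even hp, ← toggle_of_mem_odd hp h]
      rw [h1] at h
      grind
    · have h1 := commonRun_eq_succ (fun p hp => toggle_of_mem_even (p := p) hp h)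
      have h2 : Odd (commonRun s (toggle s f)) := by rw [h1]; grind
      have h3 := toggle_of_mem_odd hp h2
      rw [toggle_of_mem_even hp h] at h3
      exact (List.cons.inj h3).2.symm
  · rw [toggle_of_notMem hp, toggle_of_notMem hp]

lemma notMem_of_adj {s t : V} (hst : G.Adj s t) {p : {p : Sym2 V // p ∉ G.edgeSet}}
    (hp : s ∈ p.1) : t ∉ p.1 := by
  intro ht
  exact p.2 ((Sym2.mem_and_mem_iff hst.ne).1 ⟨hp, ht⟩ ▸ hst)

/-- No non-adjacent pair contains both ends of an edge, so the two toggles read and change disjoint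
sets of coordinates. -/
lemma toggle_comm {s t : V} (hst : G.Adj s t) (f : PairWords G) :
    toggle s (toggle t f) = toggle t (toggle s f) := by
  have aux : ∀ {s t : V}, G.Adj s t → ∀ p : {p : Sym2 V // p ∉ G.edgeSet}, s ∈ p.1 →
      toggle s (toggle t f) p = toggle t (toggle s f) p := by
    intro s t hst p hp
    have hr : commonRun s (toggle t f) = commonRun s f :=
      commonRun_congr fun p hp => toggle_of_notMem (notMem_of_adj hst hp)
    have hn := notMem_of_adj hst hp
    rw [toggle_of_notMem (f := toggle s f) hn]
    simp only [toggle.eq_1 s, hr, toggle_of_notMem hn]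
  funext p
  by_cases hs : s ∈ p.1
  · exact aux hst p hs
  · by_cases ht : t ∈ p.1
    · exact (aux hst.symm p ht).symm
    · simp only [toggle_of_notMem hs, toggle_of_notMem ht]

/-! ### The group action and the criterion for geodesic words -/

variable (G)

/-- `toggle` as a permutation. -/
def togglePerm (s : V) : Equiv.Perm (PairWords G) :=
  Function.Involutive.toPerm (toggle s) (toggle_toggle s)

lemma togglePerm_mul_self (s : V) : togglePerm G s * togglePerm G s = 1 :=
  Equiv.ext fun f => toggle_toggle s f

open Classical in
lemma isLiftable_togglePerm : (racgMatrix G).IsLiftable (togglePerm G) := by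
  intro s t
  by_cases hst : s = t
  · subst hst
    rw [togglePerm_mul_self, one_pow]
  · by_cases h : G.Adj s t
    · have hM : racgMatrix G s t = 2 := by
        change (if s = t then 1 else if G.Adj s t then 2 else 0) = 2
        rw [if_neg hst, if_pos h]
      have hc : Commute (togglePerm G s) (togglePerm G t) := Equiv.ext fun f => toggle_comm h f
      rw [hM, hc.mul_pow, sq, sq, togglePerm_mul_self, togglePerm_mul_self, one_mul]
    · have hM : racgMatrix G s t = 0 := by
        change (if s = t then 1 else if G.Adj s t then 2 else 0) = 0
        rw [if_neg hst, if_neg h]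
      rw [hM, pow_zero]

/-- The action of the right-angled Coxeter group on the families of words. -/
def pairAction : RACG G →* Equiv.Perm (PairWords G) :=
  (racgSystem G).lift ⟨togglePerm G, isLiftable_togglePerm G⟩

lemma pairAction_simple (s : V) : pairAction G ((racgSystem G).simple s) = togglePerm G s :=
  (racgSystem G).lift_apply_simple (isLiftable_togglePerm G) s

lemma pairAction_wordProd_cons (s : V) (l : List V) (f : PairWords G) :
    pairAction G ((racgSystem G).wordProd (s :: l)) f =
      toggle s (pairAction G ((racgSystem G).wordProd l) f) := by
  rw [CoxeterSystem.wordProd_cons, map_mul, pairAction_simple]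
  rfl

-- Only the letter `s` touches the coordinate at `{s, s}`, and it lengthens it by at most one.
open Classical in
lemma length_pairAction_le (l : List V) (s : V) :
    (pairAction G ((racgSystem G).wordProd l) (fun _ => []) ⟨s(s, s), by simp⟩).length ≤
      l.count s := by
  induction l with
  | nil => simp
  | cons a l ih =>
    rw [pairAction_wordProd_cons]
    by_cases ha : a = s
    · subst ha
      rw [toggle, List.count_cons_self, if_pos (by simp)]
      split_ifs
      · rw [List.length_tail]; omega
      · simpa using ih
    · rw [toggle_of_notMem (by simpa using ha), List.count_cons_of_ne ha]
      exact ih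

-- The obstruction to moving `s` forward is the first letter `a` not adjacent to `s`; the projection
-- to `{s, a}` then starts with `a ≠ s`. If there is no such letter, `s` does not occur and `{s, s}`
-- serves.
open Classical in
lemma exists_headRun_eq_zero {s : V} {l : List V} (h : ¬ Cancels G s l) :
    ∃ p : {p : Sym2 V // p ∉ G.edgeSet}, s ∈ p.1 ∧
      headRun s (l.filter fun a => a ∈ p.1) = 0 := by
  induction l with
  | nil => exact ⟨⟨s(s, s), by simp⟩, by simp, by simp [headRun]⟩
  | cons a l ih =>
    simp only [Cancels, not_or, not_and] at h
    by_cases ha : G.Adj s a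
    · obtain ⟨p, hp, h0⟩ := ih (h.2 ha)
      refine ⟨p, hp, ?_⟩
      rwa [List.filter_cons_of_neg (by simpa using notMem_of_adj ha hp)]
    · refine ⟨⟨s(s, a), by simpa using ha⟩, by simp, ?_⟩
      rw [List.filter_cons_of_pos (by simp)]
      simp [headRun, h.1]

-- In a reduced word the common run is `0` whenever a letter is prepended, so every toggle adds its
-- letter and none removes one.
open Classical in
lemma pairAction_of_reduced {l : List V} (h : Reduced G l) :
    pairAction G ((racgSystem G).wordProd l) (fun _ => []) =
      fun p => l.filter fun a => a ∈ p.1 := by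
  induction l with
  | nil => simp
  | cons s l ih =>
    rw [pairAction_wordProd_cons, ih h.2]
    obtain ⟨p, hp, h0⟩ := exists_headRun_eq_zero G h.1
    have hr : commonRun s (fun p : {p : Sym2 V // p ∉ G.edgeSet} => l.filter fun a => a ∈ p.1) = 0 :=
      Nat.le_zero.1 (h0 ▸ commonRun_le
        (fun p : {p : Sym2 V // p ∉ G.edgeSet} => l.filter fun a => a ∈ p.1) p hp)
    funext p
    by_cases hp : s ∈ p.1
    · rw [toggle_of_mem_even hp (by rw [hr]; simp), List.filter_cons_of_pos (by simpa using hp)]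
    · rw [toggle_of_notMem hp, List.filter_cons_of_neg (by simpa using hp)]

lemma isGeodesic_of_reduced {l : List V} (h : Reduced G l) : IsGeodesic G l := by
  classical
  refine le_antisymm ((racgSystem G).length_wordProd_le l) ?_
  obtain ⟨l', hl', he⟩ := (racgSystem G).exists_isReduced ((racgSystem G).wordProd l)
  rw [he, hl'.eq]
  -- For a shortest word `l'` with the same product, every letter occurs in `l` at most as often as
  -- in `l'`.
  refine (List.subperm_ext_iff.2 fun s _ => ?_).length_le
  have h1 := length_pairAction_le G l' s
  rw [← he, pairAction_of_reduced G h] at h1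
  refine le_trans (le_of_eq ?_) h1
  rw [List.count, List.countP_eq_length_filter]
  congr 2
  funext a
  simp [beq_eq_decide]

open Classical in
lemma exists_length_lt_of_cancels {s : V} {l : List V} (h : Cancels G s l) :
    ∃ l' : List V, l'.length < l.length ∧
      (racgSystem G).wordProd (s :: l) = (racgSystem G).wordProd l' := by
  induction l with
  | nil => exact h.elim
  | cons a l ih =>
    rcases h with rfl | ⟨ha, h⟩
    · exact ⟨l, by simp, by simp [CoxeterSystem.wordProd_cons]⟩
    · obtain ⟨l', hl, he⟩ := ih h
      refine ⟨a :: l', by simpa using hl, ?_⟩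
      have hM : racgMatrix G s a = 2 := by
        change (if s = a then 1 else if G.Adj s a then 2 else 0) = 2
        rw [if_neg ha.ne, if_pos ha]
      have h2 := (racgSystem G).simple_mul_simple_pow s a
      rw [hM, sq] at h2
      have hc : (racgSystem G).simple s * (racgSystem G).simple a =
          (racgSystem G).simple a * (racgSystem G).simple s := by
        rw [mul_eq_one_iff_eq_inv.1 h2]
        simp
      simp only [CoxeterSystem.wordProd_cons] at he ⊢
      rw [← mul_assoc, hc, mul_assoc, he]

lemma isGeodesic_iff_reduced (l : List V) : IsGeodesic G l ↔ Reduced G l := by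
  refine ⟨fun h => ?_, isGeodesic_of_reduced G⟩
  induction l with
  | nil => trivial
  | cons s l ih =>
    refine ⟨fun hc => ?_, ih (CoxeterSystem.IsReduced.drop (cs := racgSystem G) h 1)⟩
    obtain ⟨l', hl, he⟩ := exists_length_lt_of_cancels G hc
    have h1 := (racgSystem G).length_wordProd_le l'
    rw [← he, h] at h1
    simp only [List.length_cons] at h1
    omega

end Words

end GeodesicGrowth

end

noncomputable section

namespace GeodesicGrowth

/-! ### The geodesic growth series of a triangle-free graph -/

section AdjSum

variable {V : Type*} [Fintype V] {R : Type*} [CommRing R]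

open Classical in
/-- The sum of `f` over the neighbours of `v`. -/
def adjSum (G : SimpleGraph V) (f : V → R) (v : V) : R :=
  ∑ a, if G.Adj v a then f a else 0

lemma adjSum_sub (G : SimpleGraph V) (f g : V → R) (v : V) :
    adjSum G (fun a => f a - g a) v = adjSum G f v - adjSum G g v := by
  simp only [adjSum, ← Finset.sum_sub_distrib]
  refine Finset.sum_congr rfl fun a _ => ?_
  split_ifs <;> simp

lemma adjSum_add (G : SimpleGraph V) (f g : V → R) (v : V) :
    adjSum G (fun a => f a + g a) v = adjSum G f v + adjSum G g v := by
  simp only [adjSum, ← Finset.sum_add_distrib]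
  refine Finset.sum_congr rfl fun a _ => ?_
  split_ifs <;> simp

lemma adjSum_mul_left (G : SimpleGraph V) (c : R) (f : V → R) (v : V) :
    adjSum G (fun a => c * f a) v = c * adjSum G f v := by
  simp only [adjSum, Finset.mul_sum]
  refine Finset.sum_congr rfl fun a _ => ?_
  split_ifs <;> simp

lemma adjSum_const (G : SimpleGraph V) (c : R) (v : V) :
    adjSum G (fun _ => c) v = adjSum G (fun _ => 1) v * c := by
  rw [mul_comm, ← adjSum_mul_left]
  simp

lemma adjSum_congr {G : SimpleGraph V} {f g : V → R} {v : V} (h : ∀ a, G.Adj v a → f a = g a) :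
    adjSum G f v = adjSum G g v := by
  refine Finset.sum_congr rfl fun a _ => ?_
  split_ifs with ha
  · exact h a ha
  · rfl

lemma map_adjSum {S : Type*} [CommRing S] (φ : R →+* S) (G : SimpleGraph V) (f : V → R) (v : V) :
    φ (adjSum G f v) = adjSum G (fun a => φ (f a)) v := by
  simp only [adjSum, map_sum]
  refine Finset.sum_congr rfl fun a _ => ?_
  split_ifs <;> simp

lemma sum_mul_adjSum_comm (G : SimpleGraph V) (f g : V → R) :
    ∑ v, g v * adjSum G f v = ∑ v, f v * adjSum G g v := by
  simp only [adjSum, Finset.mul_sum]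
  rw [Finset.sum_comm]
  refine Finset.sum_congr rfl fun a _ => Finset.sum_congr rfl fun b _ => ?_
  by_cases h : G.Adj a b
  · simp [h, h.symm, mul_comm]
  · simp [h, mt SimpleGraph.Adj.symm h]

end AdjSum

/-! ### Counting reduced words by their first letter -/

section Growth

variable {V : Type*} (G : SimpleGraph V)

/-- The number of reduced words of length `m` with the property `φ`. -/
def reducedCount (m : ℕ) (φ : List V → Prop) : ℤ :=
  ({l : List V | l.length = m ∧ Reduced G l ∧ φ l}.ncard : ℤ)

lemma geodesicGrowth_eq_reducedCount (m : ℕ) :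
    (geodesicGrowth G m : ℤ) = reducedCount G m fun _ => True := by
  simp only [geodesicGrowth, reducedCount, isGeodesic_iff_reduced, and_true]

lemma reducedCount_congr {m : ℕ} {φ ψ : List V → Prop} (h : ∀ l, φ l ↔ ψ l) :
    reducedCount G m φ = reducedCount G m ψ := by
  simp only [reducedCount, h]

lemma reducedCount_false {m : ℕ} {φ : List V → Prop} (h : ∀ l, ¬ φ l) :
    reducedCount G m φ = 0 := by
  simp [reducedCount, h]

lemma reducedCount_zero (φ : List V → Prop) (h : φ []) : reducedCount G 0 φ = 1 := by
  have : {l : List V | l.length = 0 ∧ Reduced G l ∧ φ l} = {[]} := by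
    ext l
    simp only [Set.mem_ofPred_eq, List.length_eq_zero_iff, Set.mem_singleton_iff]
    exact ⟨fun h => h.1, fun hl => ⟨hl, by rw [hl]; trivial, by rwa [hl]⟩⟩
  rw [reducedCount, this, Set.ncard_singleton, Nat.cast_one]

lemma reducedCount_zero_of_not (φ : List V → Prop) (h : ¬ φ []) : reducedCount G 0 φ = 0 := by
  have : {l : List V | l.length = 0 ∧ Reduced G l ∧ φ l} = ∅ := by
    ext l
    simp only [Set.mem_ofPred_eq, List.length_eq_zero_iff, Set.mem_empty_iff_false, iff_false]
    rintro ⟨rfl, -, h'⟩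
    exact h h'
  rw [reducedCount, this, Set.ncard_empty, Nat.cast_zero]

variable [Fintype V]

lemma finite_words (m : ℕ) (φ : List V → Prop) :
    {l : List V | l.length = m ∧ φ l}.Finite :=
  (List.finite_length_eq V m).subset fun _ h => h.1

lemma reducedCount_not_and (m : ℕ) (φ ψ : List V → Prop) :
    reducedCount G m (fun l => ¬ φ l ∧ ψ l) =
      reducedCount G m ψ - reducedCount G m (fun l => φ l ∧ ψ l) := by
  have h := Set.ncard_inter_add_ncard_sdiff_eq_ncard
    {l : List V | l.length = m ∧ Reduced G l ∧ ψ l} {l : List V | φ l} (finite_words m _)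
  rw [reducedCount, reducedCount, reducedCount, ← h]
  have h1 : {l : List V | l.length = m ∧ Reduced G l ∧ ψ l} ∩ {l : List V | φ l} =
      {l : List V | l.length = m ∧ Reduced G l ∧ φ l ∧ ψ l} := by
    ext l; simp only [Set.mem_inter_iff, Set.mem_ofPred_eq]; tauto
  have h2 : {l : List V | l.length = m ∧ Reduced G l ∧ ψ l} \ {l : List V | φ l} =
      {l : List V | l.length = m ∧ Reduced G l ∧ ¬ φ l ∧ ψ l} := by
    ext l; simp only [Set.mem_sdiff, Set.mem_ofPred_eq]; tauto
  rw [h1, h2]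
  push_cast
  ring

lemma reducedCount_not (m : ℕ) (φ : List V → Prop) :
    reducedCount G m (fun l => ¬ φ l) =
      reducedCount G m (fun _ => True) - reducedCount G m φ := by
  simpa using reducedCount_not_and G m φ fun _ => True

lemma reducedCount_succ (m : ℕ) (φ : List V → Prop) :
    reducedCount G (m + 1) φ =
      ∑ a, reducedCount G m (fun l => ¬ Cancels G a l ∧ φ (a :: l)) := by
  simp only [reducedCount]
  rw [← Nat.cast_sum]
  congr 1
  have : ∀ a : V, Finite {l : List V | l.length = m ∧ Reduced G l ∧ ¬ Cancels G a l ∧ φ (a :: l)} :=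
    fun a => (finite_words m _).to_subtype
  simp only [← Nat.card_coe_set_eq]
  rw [← Nat.card_sigma]
  refine Nat.card_congr ⟨fun x => match x with
      | ⟨[], h⟩ => absurd h.1 (by simp)
      | ⟨a :: l, h⟩ => ⟨a, l, by simpa using h.1, h.2.1.2, h.2.1.1, h.2.2⟩,
    fun x => ⟨x.1 :: x.2.1, by simpa using x.2.2.1, ⟨x.2.2.2.2.1, x.2.2.2.1⟩, x.2.2.2.2.2⟩, ?_, ?_⟩
  · rintro ⟨_ | ⟨a, l⟩, h⟩
    · exact absurd h.1 (by simp)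
    · rfl
  · rintro ⟨a, l, h⟩
    rfl

open PowerSeries

/-- The generating series of the reduced words whose product is shortened by `v`. -/
def cancelSeries (v : V) : PowerSeries ℤ :=
  PowerSeries.mk fun m => reducedCount G m (Cancels G v)

/-- The generating series of the reduced words whose product is shortened by `u` and by `v`. -/
def cancelPairSeries (u v : V) : PowerSeries ℤ :=
  PowerSeries.mk fun m => reducedCount G m fun l => Cancels G u l ∧ Cancels G v l

lemma eq_C_add_X_mul {P Q : PowerSeries ℤ} {c : ℤ} (h0 : coeff 0 P = c)
    (h : ∀ m, coeff (m + 1) P = coeff m Q) : P = C c + X * Q := by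
  ext m
  cases m with
  | zero => simpa using h0
  | succ m => rw [h, map_add, coeff_succ_X_mul, coeff_C, if_neg (Nat.succ_ne_zero m), zero_add]

lemma geodesicGrowthSeries_eq :
    geodesicGrowthSeries G = 1 + X * ((Fintype.card V : PowerSeries ℤ) * geodesicGrowthSeries G -
      ∑ v, cancelSeries G v) := by
  rw [← map_one C]
  refine eq_C_add_X_mul ?_ fun m => ?_
  · simp [geodesicGrowthSeries, geodesicGrowth_eq_reducedCount, reducedCount_zero]
  · have hc : (Fintype.card V : PowerSeries ℤ) * geodesicGrowthSeries G =
        ∑ _v : V, geodesicGrowthSeries G := by simp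
    rw [hc, ← Finset.sum_sub_distrib, map_sum]
    simp only [geodesicGrowthSeries, coeff_mk, geodesicGrowth_eq_reducedCount, reducedCount_succ,
      reducedCount_not, map_sub, cancelSeries, and_true]

/-- If `v` cancels into `a :: l`, then either `a = v`, where reducedness says that `v` does not
cancel into `l`, or `a` is a neighbour of `v`, and `l` is cancelled by `v` but not by `a`. -/
lemma cancelSeries_eq (v : V) :
    cancelSeries G v = X * (geodesicGrowthSeries G - cancelSeries G v +
      adjSum G (fun a => cancelSeries G v - cancelPairSeries G v a) v) := by
  classical
  rw [← zero_add (X * _), ← map_zero C]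
  refine eq_C_add_X_mul ?_ fun m => ?_
  · simpa [cancelSeries] using reducedCount_zero_of_not G (Cancels G v) id
  · simp only [map_add, map_sub, adjSum, map_sum, cancelSeries, coeff_mk, reducedCount_succ,
      geodesicGrowthSeries, geodesicGrowth_eq_reducedCount, cancelPairSeries]
    -- The contribution of `a = v` is written as a sum over all letters, so that the identity can be
    -- checked letter by letter.
    have h1 : reducedCount G m (fun _ => True) - reducedCount G m (Cancels G v) =
        ∑ a, if a = v then
          reducedCount G m (fun _ => True) - reducedCount G m (Cancels G v) else 0 := by simp
    rw [h1, ← Finset.sum_add_distrib]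
    refine Finset.sum_congr rfl fun a _ => ?_
    by_cases hav : a = v
    · subst hav
      simp [Cancels, reducedCount_not]
    · by_cases hadj : G.Adj v a
      · have := reducedCount_not_and G m (Cancels G a) (Cancels G v)
        simp only [Cancels, hav, hadj, if_true, if_false, false_or, true_and, this, map_sub,
          coeff_mk, zero_add]
        rw [reducedCount_congr G fun l => and_comm]
      · simp [hav, hadj, Cancels, reducedCount_false]

/-- A first letter other than `u` and `v` would have to be adjacent to both, which would make a
triangle. So only the first letters `u` and `v` contribute. -/
lemma cancelPairSeries_eq (htri : G.CliqueFree 3) {u v : V} (huv : G.Adj u v) :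
    cancelPairSeries G u v = X * (cancelSeries G u + cancelSeries G v -
      2 * cancelPairSeries G u v) := by
  classical
  have h2 : (2 : PowerSeries ℤ) = C 2 := by simp
  rw [← zero_add (X * _), ← map_zero C, h2]
  refine eq_C_add_X_mul ?_ fun m => ?_
  · simp [cancelPairSeries, reducedCount_zero_of_not, Cancels]
  · simp only [map_add, map_sub, coeff_C_mul, cancelSeries, coeff_mk, cancelPairSeries]
    rw [reducedCount_succ]
    have hu := reducedCount_not_and G m (Cancels G u) (Cancels G v)
    have hv := reducedCount_not_and G m (Cancels G v) (Cancels G u)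
    rw [reducedCount_congr G fun l => and_comm (a := Cancels G v l) (b := Cancels G u l)] at hv
    have hsum : ∀ a, reducedCount G m (fun l => ¬ Cancels G a l ∧
        Cancels G u (a :: l) ∧ Cancels G v (a :: l)) =
        (if a = u then reducedCount G m (fun l => ¬ Cancels G u l ∧ Cancels G v l) else 0) +
        (if a = v then reducedCount G m (fun l => ¬ Cancels G v l ∧ Cancels G u l) else 0) := by
      intro a
      by_cases hau : a = u
      · subst hau
        simp [Cancels, huv.ne, huv.symm]
      · by_cases hav : a = v
        · subst hav
          simp [Cancels, huv.ne', huv]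
        · simp only [hau, hav, if_false, add_zero]
          refine reducedCount_false G fun l h => ?_
          simp only [Cancels, hau, hav, false_or] at h
          exact htri {u, v, a} (SimpleGraph.is3Clique_triple_iff.2 ⟨huv, h.2.1.1, h.2.2.1⟩)
    simp only [hsum, Finset.sum_add_distrib, Finset.sum_ite_eq', Finset.mem_univ, if_true, hu, hv]
    ring

/-- The generating series satisfy a linear system in which the degrees and the adjacency matrix
enter as a pencil. -/
lemma cancelSeries_pencil (htri : G.CliqueFree 3) (v : V) :
    (1 + X) * (1 + 2 * X - X * adjSum G (fun _ => 1) v) * cancelSeries G v +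
      X ^ 2 * adjSum G (cancelSeries G) v = X * (1 + 2 * X) * geodesicGrowthSeries G := by
  have h1 := cancelSeries_eq G v
  have h2 : adjSum G (cancelPairSeries G v) v =
      X * (adjSum G (fun _ => 1) v * cancelSeries G v + adjSum G (cancelSeries G) v -
        2 * adjSum G (cancelPairSeries G v) v) := by
    conv_lhs => rw [adjSum_congr fun a ha => cancelPairSeries_eq G htri ha]
    rw [adjSum_mul_left, adjSum_sub, adjSum_add, adjSum_mul_left, adjSum_const]
  rw [adjSum_sub, adjSum_const] at h1
  -- Summing the pair series over the neighbours gives `(1 + 2t) ∑ P = t (deg v * C v + ∑ C a)`;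
  -- this eliminates `∑ P` from `h1`.
  linear_combination (1 + 2 * X) * h1 - X * h2

end Growth

end GeodesicGrowth

end

noncomputable section

namespace GeodesicGrowth

/-! ### Linear systems on coalescences -/

section Coalescence

variable {V W : Type*} (τ : SimpleGraph V) (r : V) (σ : SimpleGraph W) (s : W)

open Classical in
/-- The inclusion of the second graph into the coalescence. -/
def coalescenceInr (w : W) : V ⊕ {w : W // w ≠ s} :=
  if h : w = s then .inl r else .inr ⟨w, h⟩

@[simp] lemma coalescenceInr_root : coalescenceInr r s s = .inl r := by
  simp [coalescenceInr]

@[simp] lemma coalescenceInr_coe (w : {w : W // w ≠ s}) : coalescenceInr r s w = .inr w := by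
  simp [coalescenceInr, w.2]

variable [Fintype V] [Fintype W] [DecidableEq W] {R : Type*} [CommRing R]

lemma sum_coalescence (f : V ⊕ {w : W // w ≠ s} → R) :
    ∑ x, f x = ∑ v, f (.inl v) + (∑ w, f (coalescenceInr r s w) - f (.inl r)) := by
  rw [Fintype.sum_sum_type, Fintype.sum_eq_add_sum_subtype_ne (fun w => f (coalescenceInr r s w)) s]
  simp

open Classical in
lemma adjSum_coalescence_inl (f : V ⊕ {w : W // w ≠ s} → R) (a : V) :
    adjSum (coalescence τ r σ s) f (.inl a) = adjSum τ (fun v => f (.inl v)) a +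
      if a = r then adjSum σ (fun w => f (coalescenceInr r s w)) s else 0 := by
  rw [adjSum, Fintype.sum_sum_type]
  congr 1
  rw [adjSum, Fintype.sum_eq_add_sum_subtype_ne _ s]
  by_cases ha : a = r
  · simp [ha, coalescence]
  · simp [ha, coalescence]

lemma adjSum_coalescence_inr (f : V ⊕ {w : W // w ≠ s} → R) (w : {w : W // w ≠ s}) :
    adjSum (coalescence τ r σ s) f (.inr w) =
      adjSum σ (fun w => f (coalescenceInr r s w)) w := by
  rw [adjSum, Fintype.sum_sum_type, adjSum, Fintype.sum_eq_add_sum_subtype_ne _ s]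
  have hadj : ∀ a, (coalescence τ r σ s).Adj (.inr w) (.inl a) ↔ a = r ∧ σ.Adj s w :=
    fun _ => Iff.rfl
  congr 1
  · by_cases hw : σ.Adj s w
    · rw [Finset.sum_eq_single r (fun b _ hb => if_neg fun h => hb ((hadj b).1 h).1) (by simp),
        if_pos ((hadj r).2 ⟨rfl, hw⟩), if_pos hw.symm, coalescenceInr_root]
    · simp [coalescence, hw, mt SimpleGraph.Adj.symm hw]
  · refine Finset.sum_congr rfl fun x _ => ?_
    rw [coalescenceInr_coe]
    rfl

/-- The solutions `z` of the linear system `u (u + 1 - deg w) z w + ∑ z = c` at the vertices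
`w ≠ s`, where the sum is over the neighbours of `w`, respond linearly to `c` and to the value at
the root, with coefficients `g / q`, `h / q` and `k / q`. -/
def HasResponse (u q g h k : R) : Prop :=
  ∀ (z : W → R) (c : R),
    (∀ w, w ≠ s → u * (u + 1 - adjSum σ (fun _ => 1) w) * z w + adjSum σ z w = c) →
    q * adjSum σ z s = c * h - g * z s ∧ q * (∑ w, z w - z s) = c * k - h * z s

variable {τ r s} {σ₁ σ₂ : SimpleGraph W}

/-- Rooted graphs with the same response are interchangeable in a coalescence. -/
theorem HasResponse.sum_coalescence_eq {u q g h k : R} (h₁ : HasResponse σ₁ s u q g h k)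
    (h₂ : HasResponse σ₂ s u q g h k)
    (hdeg : adjSum σ₁ (fun _ => (1 : R)) s = adjSum σ₂ (fun _ => (1 : R)) s)
    {Z₁ Z₂ : V ⊕ {w : W // w ≠ s} → R} {c₁ c₂ : R}
    (hZ₁ : ∀ x, u * (u + 1 - adjSum (coalescence τ r σ₁ s) (fun _ => 1) x) * Z₁ x +
      adjSum (coalescence τ r σ₁ s) Z₁ x = c₁)
    (hZ₂ : ∀ x, u * (u + 1 - adjSum (coalescence τ r σ₂ s) (fun _ => 1) x) * Z₂ x +
      adjSum (coalescence τ r σ₂ s) Z₂ x = c₂) :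
    q * (c₁ * ∑ x, Z₂ x) = q * (c₂ * ∑ x, Z₁ x) := by
  classical
  -- The second part pairs the equations on `τ` with an arbitrary `Y`. Its right-hand side is a
  -- symmetric bilinear form in `Z` and `Y` that depends on `σ` only through the response and the
  -- root degree.
  have key : ∀ {σ : SimpleGraph W} {Z : V ⊕ {w : W // w ≠ s} → R} {c : R},
      HasResponse σ s u q g h k →
      adjSum σ (fun _ => (1 : R)) s = adjSum σ₂ (fun _ => (1 : R)) s →
      (∀ x, u * (u + 1 - adjSum (coalescence τ r σ s) (fun _ => 1) x) * Z x +
        adjSum (coalescence τ r σ s) Z x = c) →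
      (q * ∑ x, Z x = q * ∑ v, Z (.inl v) + c * k - h * Z (.inl r)) ∧
      ∀ Y : V → R, c * (q * ∑ v, Y v - h * Y r) =
        q * ∑ v, u * (u + 1 - adjSum τ (fun _ => 1) v) * Z (.inl v) * Y v +
        q * ∑ v, Y v * adjSum τ (fun v => Z (.inl v)) v -
        (q * u * adjSum σ₂ (fun _ => 1) s + g) * Z (.inl r) * Y r := by
    intro σ Z c hσ hd hZ
    obtain ⟨hs, ht⟩ := hσ (fun w => Z (coalescenceInr r s w)) c fun w hw => by
      have := hZ (.inr ⟨w, hw⟩)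
      rw [adjSum_coalescence_inr, adjSum_coalescence_inr] at this
      have hw' := coalescenceInr_coe r s ⟨w, hw⟩
      simpa only [hw'] using this
    simp only [coalescenceInr_root] at hs ht
    refine ⟨by rw [sum_coalescence r s]; linear_combination ht, fun Y => ?_⟩
    have hv : ∀ v, c * Y v = u * (u + 1 - adjSum τ (fun _ => 1) v) * Z (.inl v) * Y v +
        Y v * adjSum τ (fun v => Z (.inl v)) v +
        if v = r then (adjSum σ (fun w => Z (coalescenceInr r s w)) s -
          u * adjSum σ₂ (fun _ => 1) s * Z (.inl r)) * Y r else 0 := by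
      intro v
      have := hZ (.inl v)
      rw [adjSum_coalescence_inl, adjSum_coalescence_inl, hd] at this
      split_ifs at this ⊢ with hvr
      · subst hvr
        linear_combination -Y v * this
      · linear_combination -Y v * this
    have hsum := Finset.sum_congr (rfl : (Finset.univ : Finset V) = _) fun v _ => hv v
    rw [← Finset.mul_sum, Finset.sum_add_distrib, Finset.sum_add_distrib,
      Finset.sum_ite_eq' Finset.univ r, if_pos (Finset.mem_univ r)] at hsum
    linear_combination q * hsum + Y r * hs
  obtain ⟨t₁, e₁⟩ := key h₁ hdeg hZ₁
  obtain ⟨t₂, e₂⟩ := key h₂ rfl hZ₂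
  -- Each solution is tested against the other. By symmetry the bilinear forms cancel, so the system
  -- on `τ` need not be invertible.
  have e₁' := e₁ fun v => Z₂ (.inl v)
  have e₂' := e₂ fun v => Z₁ (.inl v)
  rw [sum_mul_adjSum_comm] at e₁'
  have hc : ∑ v, u * (u + 1 - adjSum τ (fun _ => 1) v) * Z₁ (.inl v) * Z₂ (.inl v) =
      ∑ v, u * (u + 1 - adjSum τ (fun _ => 1) v) * Z₂ (.inl v) * Z₁ (.inl v) :=
    Finset.sum_congr rfl fun v _ => by ring
  rw [hc] at e₁'
  linear_combination c₁ * t₂ - c₂ * t₁ + e₁' - e₂'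

end Coalescence

end GeodesicGrowth

end

noncomputable section

namespace GeodesicGrowth

/-! ### The response of McKay's trees -/

section McKay

/-- The neighbours of the vertices of `mckayT1`. -/
def mckayNeighborsOne : Fin 16 → Finset (Fin 16) :=
  ![{1, 2}, {0, 3, 4}, {0, 5}, {1, 6}, {1, 7}, {2, 8, 9}, {3}, {4}, {5, 10}, {5, 11}, {8, 12},
    {9, 13}, {10}, {11, 14, 15}, {13}, {13}]

lemma mckayT1_adj_iff (a b : Fin 16) : mckayT1.Adj a b ↔ b ∈ mckayNeighborsOne a := by
  simp only [mckayT1, SimpleGraph.fromEdgeSet_adj, Set.mem_insert_iff, Set.mem_singleton_iff]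
  revert a b
  decide +kernel

/-- The neighbours of the vertices of `mckayT2`. -/
def mckayNeighborsTwo : Fin 16 → Finset (Fin 16) :=
  ![{1, 2}, {0, 3}, {0, 4, 5}, {1, 6, 7}, {2, 8}, {2, 9}, {3}, {3}, {4, 10}, {5, 11}, {8}, {9,
    12, 13}, {11, 14}, {11, 15}, {12}, {13}]

lemma mckayT2_adj_iff (a b : Fin 16) : mckayT2.Adj a b ↔ b ∈ mckayNeighborsTwo a := by
  simp only [mckayT2, SimpleGraph.fromEdgeSet_adj, Set.mem_insert_iff, Set.mem_singleton_iff]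
  revert a b
  decide +kernel

variable {R : Type*} [CommRing R]

lemma adjSum_mckayT1 (z : Fin 16 → R) (w : Fin 16) :
    adjSum mckayT1 z w = ∑ b ∈ mckayNeighborsOne w, z b := by
  simp [adjSum, mckayT1_adj_iff]

lemma adjSum_mckayT2 (z : Fin 16 → R) (w : Fin 16) :
    adjSum mckayT2 z w = ∑ b ∈ mckayNeighborsTwo w, z b := by
  simp [adjSum, mckayT2_adj_iff]

/-- The common denominator of the responses of McKay's trees. -/
def mckayDen (u : R) : R :=
  u ^ 18 - 9 * u ^ 17 + 34 * u ^ 16 - 70 * u ^ 15 + 76 * u ^ 14 - u ^ 13 - 136 * u ^ 12 + 214 *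
    u ^ 11 - 133 * u ^ 10 - 58 * u ^ 9 + 183 * u ^ 8 - 141 * u ^ 7 + 18 * u ^ 6 + 60 * u ^ 5 - 47
    * u ^ 4 + 10 * u ^ 3 + 6 * u ^ 2 - 4 * u

/-- The numerator of the response at the root to the value at the root of McKay's trees. -/
def mckayRoot (u : R) : R :=
  2 * u ^ 16 - 15 * u ^ 15 + 46 * u ^ 14 - 74 * u ^ 13 + 51 * u ^ 12 + 49 * u ^ 11 - 158 * u ^
    10 + 160 * u ^ 9 - 39 * u ^ 8 - 104 * u ^ 7 + 132 * u ^ 6 - 55 * u ^ 5 - 20 * u ^ 4 + 42 * u ^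
    3 - 13 * u ^ 2 + 4

/-- The numerator of the mixed response of McKay's trees. -/
def mckayMixed (u : R) : R :=
  2 * u ^ 16 - 15 * u ^ 15 + 43 * u ^ 14 - 56 * u ^ 13 + 13 * u ^ 12 + 75 * u ^ 11 - 123 * u ^
    10 + 60 * u ^ 9 + 43 * u ^ 8 - 84 * u ^ 7 + 42 * u ^ 6 + 17 * u ^ 5 - 21 * u ^ 4 + 8 * u ^ 3 +
    5 * u ^ 2 - 2 * u

/-- The numerator of the response of the total to the right-hand side of McKay's trees. -/
def mckayTotal (u : R) : R :=
  15 * u ^ 16 - 122 * u ^ 15 + 386 * u ^ 14 - 572 * u ^ 13 + 224 * u ^ 12 + 688 * u ^ 11 - 1366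
    * u ^ 10 + 878 * u ^ 9 + 373 * u ^ 8 - 1090 * u ^ 7 + 723 * u ^ 6 + 84 * u ^ 5 - 348 * u ^ 4 +
    176 * u ^ 3 + 9 * u ^ 2 - 36 * u + 4

/-- Fifteen equations are solved for the two needed combinations of the unknowns. The denominator
`mckayDen`, of degree 18, suffices for these, although the determinant of the system has degree 30.
-/
lemma hasResponse_mckayT1 (u : R) :
    HasResponse mckayT1 0 u (mckayDen u) (mckayRoot u) (mckayMixed u) (mckayTotal u) := by
  intro z c hz
  simp only [adjSum_mckayT1] at hz ⊢
  have e1 : u * (u + 1 - 3) * z 1 + (z 0 + z 3 + z 4) = c := by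
    simpa [mckayNeighborsOne, add_assoc] using hz 1 (by decide)
  have e2 : u * (u + 1 - 2) * z 2 + (z 0 + z 5) = c := by
    simpa [mckayNeighborsOne, add_assoc] using hz 2 (by decide)
  have e3 : u * (u + 1 - 2) * z 3 + (z 1 + z 6) = c := by
    simpa [mckayNeighborsOne, add_assoc] using hz 3 (by decide)
  have e4 : u * (u + 1 - 2) * z 4 + (z 1 + z 7) = c := by
    simpa [mckayNeighborsOne, add_assoc] using hz 4 (by decide)
  have e5 : u * (u + 1 - 3) * z 5 + (z 2 + z 8 + z 9) = c := by
    simpa [mckayNeighborsOne, add_assoc] using hz 5 (by decide)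
  have e6 : u * (u + 1 - 1) * z 6 + (z 3) = c := by
    simpa [mckayNeighborsOne, add_assoc] using hz 6 (by decide)
  have e7 : u * (u + 1 - 1) * z 7 + (z 4) = c := by
    simpa [mckayNeighborsOne, add_assoc] using hz 7 (by decide)
  have e8 : u * (u + 1 - 2) * z 8 + (z 5 + z 10) = c := by
    simpa [mckayNeighborsOne, add_assoc] using hz 8 (by decide)
  have e9 : u * (u + 1 - 2) * z 9 + (z 5 + z 11) = c := by
    simpa [mckayNeighborsOne, add_assoc] using hz 9 (by decide)
  have e10 : u * (u + 1 - 2) * z 10 + (z 8 + z 12) = c := by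
    simpa [mckayNeighborsOne, add_assoc] using hz 10 (by decide)
  have e11 : u * (u + 1 - 2) * z 11 + (z 9 + z 13) = c := by
    simpa [mckayNeighborsOne, add_assoc] using hz 11 (by decide)
  have e12 : u * (u + 1 - 1) * z 12 + (z 10) = c := by
    simpa [mckayNeighborsOne, add_assoc] using hz 12 (by decide)
  have e13 : u * (u + 1 - 3) * z 13 + (z 11 + z 14 + z 15) = c := by
    simpa [mckayNeighborsOne, add_assoc] using hz 13 (by decide)
  have e14 : u * (u + 1 - 1) * z 14 + (z 13) = c := by
    simpa [mckayNeighborsOne, add_assoc] using hz 14 (by decide)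
  have e15 : u * (u + 1 - 1) * z 15 + (z 13) = c := by
    simpa [mckayNeighborsOne, add_assoc] using hz 15 (by decide)
  have h0 : ∑ b ∈ mckayNeighborsOne 0, z b = z 1 + z 2 := by simp [mckayNeighborsOne]
  have hs : ∑ w, z w - z 0 = z 1 + z 2 + z 3 + z 4 + z 5 + z 6 + z 7 + z 8 + z 9 + z 10 + z 11 +
      z 12 + z 13 + z 14 + z 15 := by
    rw [sub_eq_iff_eq_add']
    simp only [Fin.sum_univ_succ, Fin.sum_univ_zero, Fin.reduceSucc, add_zero, add_assoc,
      Fin.succ_zero_eq_one]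
  rw [h0, hs]
  simp only [mckayDen, mckayRoot, mckayMixed, mckayTotal]
  constructor
  -- The coefficients are `mckayDen u` times the inverse of the symmetric system matrix, applied to
  -- the indicator of the neighbours of the root. In the second goal it is applied to the all-one
  -- vector.
  · linear_combination (u ^ 16 - 7 * u ^ 15 + 20 * u ^ 14 - 30 * u ^ 13 + 18 * u ^ 12 + 23 * u ^ 11 - 62 * u ^ 10 +
      58 * u ^ 9 - 11 * u ^ 8 - 40 * u ^ 7 + 47 * u ^ 6 - 19 * u ^ 5 - 8 * u ^ 4 + 16 * u ^ 3 - 5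
      * u ^ 2 + 2) * e1 + (u ^ 16 - 8 * u ^ 15 + 26 * u ^ 14 - 44 * u ^ 13 + 33 * u ^ 12 + 26 * u
      ^ 11 - 96 * u ^ 10 + 102 * u ^ 9 - 28 * u ^ 8 - 64 * u ^ 7 + 85 * u ^ 6 - 36 * u ^ 5 - 12 *
      u ^ 4 + 26 * u ^ 3 - 8 * u ^ 2 + 2) * e2 + (-u ^ 14 + 6 * u ^ 13 - 14 * u ^ 12 + 16 * u ^ 11
      - 3 * u ^ 10 - 20 * u ^ 9 + 28 * u ^ 8 - 14 * u ^ 7 - 6 * u ^ 6 + 14 * u ^ 5 - 5 * u ^ 4 + 2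
      * u ^ 2) * e3 + (-u ^ 14 + 6 * u ^ 13 - 14 * u ^ 12 + 16 * u ^ 11 - 3 * u ^ 10 - 20 * u ^ 9
      + 28 * u ^ 8 - 14 * u ^ 7 - 6 * u ^ 6 + 14 * u ^ 5 - 5 * u ^ 4 + 2 * u ^ 2) * e4 + (-u ^ 14
      + 6 * u ^ 13 - 14 * u ^ 12 + 16 * u ^ 11 - 3 * u ^ 10 - 22 * u ^ 9 + 34 * u ^ 8 - 20 * u ^ 7
      - 6 * u ^ 6 + 22 * u ^ 5 - 13 * u ^ 4 + 2 * u ^ 3 + 4 * u ^ 2 - 2 * u) * e5 + (u ^ 12 - 6 *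
      u ^ 11 + 14 * u ^ 10 - 16 * u ^ 9 + 3 * u ^ 8 + 20 * u ^ 7 - 28 * u ^ 6 + 14 * u ^ 5 + 6 * u
      ^ 4 - 14 * u ^ 3 + 5 * u ^ 2 - 2) * e6 + (u ^ 12 - 6 * u ^ 11 + 14 * u ^ 10 - 16 * u ^ 9 + 3
      * u ^ 8 + 20 * u ^ 7 - 28 * u ^ 6 + 14 * u ^ 5 + 6 * u ^ 4 - 14 * u ^ 3 + 5 * u ^ 2 - 2) *
      e7 + (u ^ 12 - 5 * u ^ 11 + 9 * u ^ 10 - 7 * u ^ 9 - 3 * u ^ 8 + 15 * u ^ 7 - 14 * u ^ 6 + 4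
      * u ^ 5 + 6 * u ^ 4 - 9 * u ^ 3 + 2 * u ^ 2 - 2) * e8 + (u ^ 12 - 5 * u ^ 11 + 9 * u ^ 10 -
      7 * u ^ 9 - 3 * u ^ 8 + 15 * u ^ 7 - 14 * u ^ 6 + 4 * u ^ 5 + 6 * u ^ 4 - 7 * u ^ 3 + 2 * u
      ^ 2) * e9 + (-u ^ 10 + 4 * u ^ 9 - 5 * u ^ 8 + 2 * u ^ 7 + 4 * u ^ 6 - 7 * u ^ 5 + 2 * u ^ 4
      - 2 * u ^ 2) * e10 + (-u ^ 10 + 4 * u ^ 9 - 5 * u ^ 8 + 2 * u ^ 7 + 4 * u ^ 6 - 9 * u ^ 5 +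
      4 * u ^ 4 - 4 * u ^ 2 + 2 * u) * e11 + (u ^ 8 - 4 * u ^ 7 + 5 * u ^ 6 - 2 * u ^ 5 - 4 * u ^
      4 + 7 * u ^ 3 - 2 * u ^ 2 + 2) * e12 + (u ^ 8 - 2 * u ^ 7 + u ^ 6 - 2 * u ^ 4 + u ^ 3) * e13
      + (-u ^ 6 + 2 * u ^ 5 - u ^ 4 + 2 * u ^ 2 - u) * e14 + (-u ^ 6 + 2 * u ^ 5 - u ^ 4 + 2 * u ^
      2 - u) * e15
  · linear_combination (u ^ 16 - 7 * u ^ 15 + 18 * u ^ 14 - 18 * u ^ 13 - 8 * u ^ 12 + 43 * u ^ 11 - 40 * u ^ 10 -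
      14 * u ^ 9 + 51 * u ^ 8 - 28 * u ^ 7 - 21 * u ^ 6 + 37 * u ^ 5 - 6 * u ^ 4 - 12 * u ^ 3 + 9
      * u ^ 2 - 2) * e1 + (u ^ 16 - 8 * u ^ 15 + 25 * u ^ 14 - 38 * u ^ 13 + 21 * u ^ 12 + 32 * u
      ^ 11 - 83 * u ^ 10 + 74 * u ^ 9 - 8 * u ^ 8 - 56 * u ^ 7 + 63 * u ^ 6 - 20 * u ^ 5 - 15 * u
      ^ 4 + 20 * u ^ 3 - 4 * u ^ 2 - 2 * u + 2) * e2 + (u ^ 16 - 8 * u ^ 15 + 24 * u ^ 14 - 30 * u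
      ^ 13 - 5 * u ^ 12 + 74 * u ^ 11 - 106 * u ^ 10 + 36 * u ^ 9 + 74 * u ^ 8 - 110 * u ^ 7 + 49
      * u ^ 6 + 30 * u ^ 5 - 40 * u ^ 4 + 14 * u ^ 3 + 4 * u ^ 2 - 4 * u) * e3 + (u ^ 16 - 8 * u ^
      15 + 24 * u ^ 14 - 30 * u ^ 13 - 5 * u ^ 12 + 74 * u ^ 11 - 106 * u ^ 10 + 36 * u ^ 9 + 74 *
      u ^ 8 - 110 * u ^ 7 + 49 * u ^ 6 + 30 * u ^ 5 - 40 * u ^ 4 + 14 * u ^ 3 + 4 * u ^ 2 - 4 * u)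
      * e4 + (u ^ 16 - 7 * u ^ 15 + 17 * u ^ 14 - 12 * u ^ 13 - 21 * u ^ 12 + 57 * u ^ 11 - 51 * u
      ^ 10 - 10 * u ^ 9 + 64 * u ^ 8 - 58 * u ^ 7 + 13 * u ^ 6 + 25 * u ^ 5 - 23 * u ^ 4 + 8 * u ^
      3 + 2 * u ^ 2 - 2 * u) * e5 + (u ^ 16 - 9 * u ^ 15 + 33 * u ^ 14 - 62 * u ^ 13 + 52 * u ^ 12
      + 29 * u ^ 11 - 131 * u ^ 10 + 140 * u ^ 9 - 27 * u ^ 8 - 94 * u ^ 7 + 109 * u ^ 6 - 31 * u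
      ^ 5 - 31 * u ^ 4 + 30 * u ^ 3 - 7 * u ^ 2 - 4 * u + 2) * e6 + (u ^ 16 - 9 * u ^ 15 + 33 * u
      ^ 14 - 62 * u ^ 13 + 52 * u ^ 12 + 29 * u ^ 11 - 131 * u ^ 10 + 140 * u ^ 9 - 27 * u ^ 8 -
      94 * u ^ 7 + 109 * u ^ 6 - 31 * u ^ 5 - 31 * u ^ 4 + 30 * u ^ 3 - 7 * u ^ 2 - 4 * u + 2) *
      e7 + (u ^ 16 - 8 * u ^ 15 + 24 * u ^ 14 - 31 * u ^ 13 + 4 * u ^ 12 + 44 * u ^ 11 - 61 * u ^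
      10 + 14 * u ^ 9 + 42 * u ^ 8 - 38 * u ^ 7 - 5 * u ^ 6 + 30 * u ^ 5 - 11 * u ^ 4 - 9 * u ^ 3
      + 8 * u ^ 2 - 2 * u - 2) * e8 + (u ^ 16 - 8 * u ^ 15 + 24 * u ^ 14 - 31 * u ^ 13 + 4 * u ^
      12 + 46 * u ^ 11 - 73 * u ^ 10 + 40 * u ^ 9 + 20 * u ^ 8 - 46 * u ^ 7 + 33 * u ^ 6 - 4 * u ^
      5 - 7 * u ^ 4 + 5 * u ^ 3 - 2 * u ^ 2) * e9 + (u ^ 16 - 8 * u ^ 15 + 24 * u ^ 14 - 29 * u ^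
      13 - 10 * u ^ 12 + 82 * u ^ 11 - 110 * u ^ 10 + 32 * u ^ 9 + 86 * u ^ 8 - 118 * u ^ 7 + 46 *
      u ^ 6 + 33 * u ^ 5 - 41 * u ^ 4 + 12 * u ^ 3 + 4 * u ^ 2 - 4 * u) * e10 + (u ^ 16 - 8 * u ^
      15 + 24 * u ^ 14 - 31 * u ^ 13 + 4 * u ^ 12 + 44 * u ^ 11 - 62 * u ^ 10 + 18 * u ^ 9 + 40 *
      u ^ 8 - 46 * u ^ 7 + 8 * u ^ 6 + 23 * u ^ 5 - 17 * u ^ 4 + 4 * u ^ 2 - 2 * u) * e11 + (u ^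
      16 - 9 * u ^ 15 + 33 * u ^ 14 - 62 * u ^ 13 + 52 * u ^ 12 + 28 * u ^ 11 - 126 * u ^ 10 + 132
      * u ^ 9 - 23 * u ^ 8 - 90 * u ^ 7 + 97 * u ^ 6 - 23 * u ^ 5 - 28 * u ^ 4 + 27 * u ^ 3 - 6 *
      u ^ 2 - 2 * u + 2) * e12 + (u ^ 16 - 7 * u ^ 15 + 17 * u ^ 14 - 10 * u ^ 13 - 34 * u ^ 12 +
      88 * u ^ 11 - 82 * u ^ 10 - 12 * u ^ 9 + 109 * u ^ 8 - 110 * u ^ 7 + 25 * u ^ 6 + 47 * u ^ 5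
      - 44 * u ^ 4 + 11 * u ^ 3 + 6 * u ^ 2 - 4 * u) * e13 + (u ^ 16 - 9 * u ^ 15 + 33 * u ^ 14 -
      63 * u ^ 13 + 59 * u ^ 12 + 9 * u ^ 11 - 102 * u ^ 10 + 126 * u ^ 9 - 51 * u ^ 8 - 46 * u ^
      7 + 74 * u ^ 6 - 31 * u ^ 5 - 7 * u ^ 4 + 13 * u ^ 3 - 3 * u ^ 2 - u) * e14 + (u ^ 16 - 9 *
      u ^ 15 + 33 * u ^ 14 - 63 * u ^ 13 + 59 * u ^ 12 + 9 * u ^ 11 - 102 * u ^ 10 + 126 * u ^ 9 -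
      51 * u ^ 8 - 46 * u ^ 7 + 74 * u ^ 6 - 31 * u ^ 5 - 7 * u ^ 4 + 13 * u ^ 3 - 3 * u ^ 2 - u)
      * e15

lemma hasResponse_mckayT2 (u : R) :
    HasResponse mckayT2 0 u (mckayDen u) (mckayRoot u) (mckayMixed u) (mckayTotal u) := by
  intro z c hz
  simp only [adjSum_mckayT2] at hz ⊢
  have e1 : u * (u + 1 - 2) * z 1 + (z 0 + z 3) = c := by
    simpa [mckayNeighborsTwo, add_assoc] using hz 1 (by decide)
  have e2 : u * (u + 1 - 3) * z 2 + (z 0 + z 4 + z 5) = c := by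
    simpa [mckayNeighborsTwo, add_assoc] using hz 2 (by decide)
  have e3 : u * (u + 1 - 3) * z 3 + (z 1 + z 6 + z 7) = c := by
    simpa [mckayNeighborsTwo, add_assoc] using hz 3 (by decide)
  have e4 : u * (u + 1 - 2) * z 4 + (z 2 + z 8) = c := by
    simpa [mckayNeighborsTwo, add_assoc] using hz 4 (by decide)
  have e5 : u * (u + 1 - 2) * z 5 + (z 2 + z 9) = c := by
    simpa [mckayNeighborsTwo, add_assoc] using hz 5 (by decide)
  have e6 : u * (u + 1 - 1) * z 6 + (z 3) = c := by
    simpa [mckayNeighborsTwo, add_assoc] using hz 6 (by decide)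
  have e7 : u * (u + 1 - 1) * z 7 + (z 3) = c := by
    simpa [mckayNeighborsTwo, add_assoc] using hz 7 (by decide)
  have e8 : u * (u + 1 - 2) * z 8 + (z 4 + z 10) = c := by
    simpa [mckayNeighborsTwo, add_assoc] using hz 8 (by decide)
  have e9 : u * (u + 1 - 2) * z 9 + (z 5 + z 11) = c := by
    simpa [mckayNeighborsTwo, add_assoc] using hz 9 (by decide)
  have e10 : u * (u + 1 - 1) * z 10 + (z 8) = c := by
    simpa [mckayNeighborsTwo, add_assoc] using hz 10 (by decide)
  have e11 : u * (u + 1 - 3) * z 11 + (z 9 + z 12 + z 13) = c := by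
    simpa [mckayNeighborsTwo, add_assoc] using hz 11 (by decide)
  have e12 : u * (u + 1 - 2) * z 12 + (z 11 + z 14) = c := by
    simpa [mckayNeighborsTwo, add_assoc] using hz 12 (by decide)
  have e13 : u * (u + 1 - 2) * z 13 + (z 11 + z 15) = c := by
    simpa [mckayNeighborsTwo, add_assoc] using hz 13 (by decide)
  have e14 : u * (u + 1 - 1) * z 14 + (z 12) = c := by
    simpa [mckayNeighborsTwo, add_assoc] using hz 14 (by decide)
  have e15 : u * (u + 1 - 1) * z 15 + (z 13) = c := by
    simpa [mckayNeighborsTwo, add_assoc] using hz 15 (by decide)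
  have h0 : ∑ b ∈ mckayNeighborsTwo 0, z b = z 1 + z 2 := by simp [mckayNeighborsTwo]
  have hs : ∑ w, z w - z 0 = z 1 + z 2 + z 3 + z 4 + z 5 + z 6 + z 7 + z 8 + z 9 + z 10 + z 11 +
      z 12 + z 13 + z 14 + z 15 := by
    rw [sub_eq_iff_eq_add']
    simp only [Fin.sum_univ_succ, Fin.sum_univ_zero, Fin.reduceSucc, add_zero, add_assoc,
      Fin.succ_zero_eq_one]
  rw [h0, hs]
  simp only [mckayDen, mckayRoot, mckayMixed, mckayTotal]
  constructor
  · linear_combination (u ^ 16 - 8 * u ^ 15 + 26 * u ^ 14 - 44 * u ^ 13 + 33 * u ^ 12 + 26 * u ^ 11 - 96 * u ^ 10 +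
      102 * u ^ 9 - 28 * u ^ 8 - 66 * u ^ 7 + 89 * u ^ 6 - 38 * u ^ 5 - 14 * u ^ 4 + 32 * u ^ 3 -
      10 * u ^ 2 + 4) * e1 + (u ^ 16 - 7 * u ^ 15 + 20 * u ^ 14 - 30 * u ^ 13 + 18 * u ^ 12 + 23 *
      u ^ 11 - 62 * u ^ 10 + 58 * u ^ 9 - 11 * u ^ 8 - 38 * u ^ 7 + 43 * u ^ 6 - 17 * u ^ 5 - 6 *
      u ^ 4 + 10 * u ^ 3 - 3 * u ^ 2) * e2 + (-u ^ 14 + 6 * u ^ 13 - 14 * u ^ 12 + 16 * u ^ 11 - 3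
      * u ^ 10 - 20 * u ^ 9 + 28 * u ^ 8 - 14 * u ^ 7 - 6 * u ^ 6 + 14 * u ^ 5 - 5 * u ^ 4 + 2 * u
      ^ 2) * e3 + (-u ^ 14 + 6 * u ^ 13 - 14 * u ^ 12 + 16 * u ^ 11 - 3 * u ^ 10 - 21 * u ^ 9 + 32
      * u ^ 8 - 19 * u ^ 7 - 5 * u ^ 6 + 20 * u ^ 5 - 13 * u ^ 4 + 2 * u ^ 3 + 4 * u ^ 2 - 3 * u)
      * e4 + (-u ^ 14 + 6 * u ^ 13 - 14 * u ^ 12 + 16 * u ^ 11 - 3 * u ^ 10 - 21 * u ^ 9 + 32 * u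
      ^ 8 - 19 * u ^ 7 - 5 * u ^ 6 + 18 * u ^ 5 - 11 * u ^ 4 + 2 * u ^ 3 + 2 * u ^ 2 - u) * e5 +
      (u ^ 12 - 6 * u ^ 11 + 14 * u ^ 10 - 16 * u ^ 9 + 3 * u ^ 8 + 20 * u ^ 7 - 28 * u ^ 6 + 14 *
      u ^ 5 + 6 * u ^ 4 - 14 * u ^ 3 + 5 * u ^ 2 - 2) * e6 + (u ^ 12 - 6 * u ^ 11 + 14 * u ^ 10 -
      16 * u ^ 9 + 3 * u ^ 8 + 20 * u ^ 7 - 28 * u ^ 6 + 14 * u ^ 5 + 6 * u ^ 4 - 14 * u ^ 3 + 5 *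
      u ^ 2 - 2) * e7 + (u ^ 12 - 5 * u ^ 11 + 9 * u ^ 10 - 7 * u ^ 9 - 3 * u ^ 8 + 13 * u ^ 7 -
      10 * u ^ 6 + 2 * u ^ 5 + 4 * u ^ 4 - 3 * u ^ 3) * e8 + (u ^ 12 - 5 * u ^ 11 + 9 * u ^ 10 - 7
      * u ^ 9 - 3 * u ^ 8 + 15 * u ^ 7 - 14 * u ^ 6 + 4 * u ^ 5 + 6 * u ^ 4 - 7 * u ^ 3 + 2 * u ^
      2) * e9 + (-u ^ 10 + 5 * u ^ 9 - 9 * u ^ 8 + 7 * u ^ 7 + 3 * u ^ 6 - 13 * u ^ 5 + 10 * u ^ 4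
      - 2 * u ^ 3 - 4 * u ^ 2 + 3 * u) * e10 + (-u ^ 10 + 3 * u ^ 9 - 3 * u ^ 8 + u ^ 7 + 3 * u ^
      6 - 5 * u ^ 5 + 2 * u ^ 4 - 2 * u ^ 2 + u) * e11 + (u ^ 8 - 2 * u ^ 7 + u ^ 6 - 2 * u ^ 4 +
      u ^ 3) * e12 + (u ^ 8 - 2 * u ^ 7 + u ^ 6 - 2 * u ^ 4 + u ^ 3) * e13 + (-u ^ 6 + 2 * u ^ 5 -
      u ^ 4 + 2 * u ^ 2 - u) * e14 + (-u ^ 6 + 2 * u ^ 5 - u ^ 4 + 2 * u ^ 2 - u) * e15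
  · linear_combination (u ^ 16 - 8 * u ^ 15 + 25 * u ^ 14 - 38 * u ^ 13 + 21 * u ^ 12 + 30 * u ^ 11 - 71 * u ^ 10 +
      50 * u ^ 9 + 6 * u ^ 8 - 40 * u ^ 7 + 27 * u ^ 6 + 4 * u ^ 5 - 7 * u ^ 4 + 4 * u ^ 3 + 2 * u
      ^ 2) * e1 + (u ^ 16 - 7 * u ^ 15 + 18 * u ^ 14 - 18 * u ^ 13 - 8 * u ^ 12 + 45 * u ^ 11 - 52
      * u ^ 10 + 10 * u ^ 9 + 37 * u ^ 8 - 44 * u ^ 7 + 15 * u ^ 6 + 13 * u ^ 5 - 14 * u ^ 4 + 4 *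
      u ^ 3 + 3 * u ^ 2 - 2 * u) * e2 + (u ^ 16 - 7 * u ^ 15 + 17 * u ^ 14 - 10 * u ^ 13 - 35 * u
      ^ 12 + 93 * u ^ 11 - 89 * u ^ 10 - 12 * u ^ 9 + 116 * u ^ 8 - 118 * u ^ 7 + 29 * u ^ 6 + 49
      * u ^ 5 - 45 * u ^ 4 + 12 * u ^ 3 + 6 * u ^ 2 - 4 * u) * e3 + (u ^ 16 - 8 * u ^ 15 + 24 * u
      ^ 14 - 31 * u ^ 13 + 3 * u ^ 12 + 49 * u ^ 11 - 69 * u ^ 10 + 18 * u ^ 9 + 46 * u ^ 8 - 50 *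
      u ^ 7 + 6 * u ^ 6 + 27 * u ^ 5 - 13 * u ^ 4 - 4 * u ^ 3 + 6 * u ^ 2 - u - 2) * e4 + (u ^ 16
      - 8 * u ^ 15 + 24 * u ^ 14 - 31 * u ^ 13 + 3 * u ^ 12 + 51 * u ^ 11 - 81 * u ^ 10 + 42 * u ^
      9 + 34 * u ^ 8 - 74 * u ^ 7 + 52 * u ^ 6 + u ^ 5 - 29 * u ^ 4 + 22 * u ^ 3 - 4 * u ^ 2 - 3 *
      u + 2) * e5 + (u ^ 16 - 9 * u ^ 15 + 33 * u ^ 14 - 63 * u ^ 13 + 59 * u ^ 12 + 9 * u ^ 11 -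
      101 * u ^ 10 + 121 * u ^ 9 - 44 * u ^ 8 - 46 * u ^ 7 + 67 * u ^ 6 - 23 * u ^ 5 - 11 * u ^ 4
      + 11 * u ^ 3 - 2 * u ^ 2 - 2 * u) * e6 + (u ^ 16 - 9 * u ^ 15 + 33 * u ^ 14 - 63 * u ^ 13 +
      59 * u ^ 12 + 9 * u ^ 11 - 101 * u ^ 10 + 121 * u ^ 9 - 44 * u ^ 8 - 46 * u ^ 7 + 67 * u ^ 6
      - 23 * u ^ 5 - 11 * u ^ 4 + 11 * u ^ 3 - 2 * u ^ 2 - 2 * u) * e7 + (u ^ 16 - 8 * u ^ 15 + 24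
      * u ^ 14 - 29 * u ^ 13 - 10 * u ^ 12 + 82 * u ^ 11 - 109 * u ^ 10 + 28 * u ^ 9 + 90 * u ^ 8
      - 118 * u ^ 7 + 43 * u ^ 6 + 38 * u ^ 5 - 43 * u ^ 4 + 13 * u ^ 3 + 4 * u ^ 2 - 4 * u) * e8
      + (u ^ 16 - 8 * u ^ 15 + 24 * u ^ 14 - 31 * u ^ 13 + 4 * u ^ 12 + 46 * u ^ 11 - 73 * u ^ 10
      + 40 * u ^ 9 + 20 * u ^ 8 - 46 * u ^ 7 + 33 * u ^ 6 - 4 * u ^ 5 - 7 * u ^ 4 + 5 * u ^ 3 - 2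
      * u ^ 2) * e9 + (u ^ 16 - 9 * u ^ 15 + 33 * u ^ 14 - 62 * u ^ 13 + 52 * u ^ 12 + 28 * u ^ 11
      - 126 * u ^ 10 + 132 * u ^ 9 - 24 * u ^ 8 - 86 * u ^ 7 + 93 * u ^ 6 - 23 * u ^ 5 - 25 * u ^
      4 + 22 * u ^ 3 - 4 * u ^ 2 - 3 * u + 2) * e10 + (u ^ 16 - 7 * u ^ 15 + 17 * u ^ 14 - 12 * u
      ^ 13 - 20 * u ^ 12 + 50 * u ^ 11 - 32 * u ^ 10 - 34 * u ^ 9 + 70 * u ^ 8 - 30 * u ^ 7 - 31 *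
      u ^ 6 + 47 * u ^ 5 - 11 * u ^ 4 - 14 * u ^ 3 + 10 * u ^ 2 - u - 2) * e11 + (u ^ 16 - 8 * u ^
      15 + 24 * u ^ 14 - 30 * u ^ 13 - 4 * u ^ 12 + 69 * u ^ 11 - 99 * u ^ 10 + 36 * u ^ 9 + 67 *
      u ^ 8 - 102 * u ^ 7 + 45 * u ^ 6 + 28 * u ^ 5 - 39 * u ^ 4 + 13 * u ^ 3 + 4 * u ^ 2 - 4 * u)
      * e12 + (u ^ 16 - 8 * u ^ 15 + 24 * u ^ 14 - 30 * u ^ 13 - 4 * u ^ 12 + 69 * u ^ 11 - 99 * u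
      ^ 10 + 36 * u ^ 9 + 67 * u ^ 8 - 102 * u ^ 7 + 45 * u ^ 6 + 28 * u ^ 5 - 39 * u ^ 4 + 13 * u
      ^ 3 + 4 * u ^ 2 - 4 * u) * e13 + (u ^ 16 - 9 * u ^ 15 + 33 * u ^ 14 - 62 * u ^ 13 + 52 * u ^
      12 + 29 * u ^ 11 - 132 * u ^ 10 + 145 * u ^ 9 - 34 * u ^ 8 - 94 * u ^ 7 + 116 * u ^ 6 - 39 *
      u ^ 5 - 27 * u ^ 4 + 32 * u ^ 3 - 8 * u ^ 2 - 3 * u + 2) * e14 + (u ^ 16 - 9 * u ^ 15 + 33 *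
      u ^ 14 - 62 * u ^ 13 + 52 * u ^ 12 + 29 * u ^ 11 - 132 * u ^ 10 + 145 * u ^ 9 - 34 * u ^ 8 -
      94 * u ^ 7 + 116 * u ^ 6 - 39 * u ^ 5 - 27 * u ^ 4 + 32 * u ^ 3 - 8 * u ^ 2 - 3 * u + 2) *
      e15

end McKay

end GeodesicGrowth

end

noncomputable section

namespace GeodesicGrowth

/-! ### Equality of the growth series -/

section GrowthEquality

open PowerSeries

/-- The field of fractions of the ring of power series. -/
abbrev SeriesField : Type := FractionRing (PowerSeries ℤ)

/-- The element `(1 + t) / t` of the field of fractions of the ring of power series. -/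
def seriesPoint : SeriesField :=
  (1 + algebraMap (PowerSeries ℤ) SeriesField X) / algebraMap (PowerSeries ℤ) SeriesField X

lemma algebraMap_series_injective :
    Function.Injective (algebraMap (PowerSeries ℤ) SeriesField) :=
  IsFractionRing.injective _ _

lemma algebraMap_X_ne_zero : algebraMap (PowerSeries ℤ) SeriesField X ≠ 0 := by
  rw [Ne, map_eq_zero_iff _ algebraMap_series_injective]
  exact X_ne_zero

variable {V W : Type*} [Fintype V] [Fintype W] [DecidableEq W]

lemma cancelSeries_field_pencil {V : Type*} [Fintype V] (G : SimpleGraph V)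
    (htri : G.CliqueFree 3) (v : V) :
    seriesPoint * (seriesPoint + 1 - adjSum G (fun _ => 1) v) *
        algebraMap (PowerSeries ℤ) SeriesField (cancelSeries G v) +
      adjSum G (fun a => algebraMap (PowerSeries ℤ) SeriesField (cancelSeries G a)) v =
    algebraMap (PowerSeries ℤ) SeriesField (1 + 2 * X) / algebraMap (PowerSeries ℤ) SeriesField X *
      algebraMap (PowerSeries ℤ) SeriesField (geodesicGrowthSeries G) := by
  have h := congrArg (algebraMap (PowerSeries ℤ) SeriesField) (cancelSeries_pencil G htri v)
  have hX := algebraMap_X_ne_zero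
  simp only [map_add, map_mul, map_sub, map_pow, map_one, map_adjSum, map_ofNat] at h ⊢
  rw [seriesPoint]
  field_simp
  linear_combination h

variable {τ : SimpleGraph V} {r : V} {σ₁ σ₂ : SimpleGraph W} {s : W}

theorem HasResponse.geodesicGrowthSeries_coalescence_eq {q g h k : SeriesField}
    (h₁ : HasResponse σ₁ s seriesPoint q g h k) (h₂ : HasResponse σ₂ s seriesPoint q g h k)
    (hq : q ≠ 0)
    (hdeg : adjSum σ₁ (fun _ => (1 : SeriesField)) s = adjSum σ₂ (fun _ => (1 : SeriesField)) s)
    (htri₁ : (coalescence τ r σ₁ s).CliqueFree 3) (htri₂ : (coalescence τ r σ₂ s).CliqueFree 3) :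
    geodesicGrowthSeries (coalescence τ r σ₁ s) = geodesicGrowthSeries (coalescence τ r σ₂ s) := by
  -- The right-hand sides are `(1 + 2t) / t` times the growth series. After cancelling that factor,
  -- each growth series times the other graph's sum of cancel series gives the same product.
  have key := h₁.sum_coalescence_eq h₂ hdeg (cancelSeries_field_pencil _ htri₁)
    (cancelSeries_field_pencil _ htri₂)
  have hX := algebraMap_X_ne_zero
  have h2 : algebraMap (PowerSeries ℤ) SeriesField (1 + 2 * X) ≠ 0 := by
    rw [Ne, map_eq_zero_iff _ algebraMap_series_injective]
    intro h0
    simpa using congrArg constantCoeff h0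
  have key' := mul_left_cancel₀ hq key
  rw [mul_assoc, mul_assoc] at key'
  have key₂ := mul_left_cancel₀ (div_ne_zero h2 hX) key'
  rw [← map_sum, ← map_sum, ← map_mul, ← map_mul] at key₂
  have key₃ := algebraMap_series_injective key₂
  have e₁ := geodesicGrowthSeries_eq (coalescence τ r σ₁ s)
  have e₂ := geodesicGrowthSeries_eq (coalescence τ r σ₂ s)
  -- Cross-multiplying the recursions for `F₁` and `F₂` cancels the terms `n F₁ F₂`, since both
  -- graphs have the same vertices; `key₃` cancels the others and leaves `F₁ = F₂`.
  linear_combination geodesicGrowthSeries (coalescence τ r σ₂ s) * e₁ -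
    geodesicGrowthSeries (coalescence τ r σ₁ s) * e₂ + X * key₃

lemma mckayDen_seriesPoint_ne_zero : mckayDen seriesPoint ≠ 0 := by
  intro h0
  have hX := algebraMap_X_ne_zero
  -- Multiplying by `t ^ 18` clears denominators; the resulting power series has constant term `1`,
  -- from `(1 + t) ^ 18`.
  have h : algebraMap (PowerSeries ℤ) SeriesField
      ((1 + X) ^ 18 - 9 * (1 + X) ^ 17 * X + 34 * (1 + X) ^ 16 * X ^ 2 - 70 * (1 + X) ^ 15 * X ^ 3 +
        76 * (1 + X) ^ 14 * X ^ 4 - (1 + X) ^ 13 * X ^ 5 - 136 * (1 + X) ^ 12 * X ^ 6 + 214 * (1 + X)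
        ^ 11 * X ^ 7 - 133 * (1 + X) ^ 10 * X ^ 8 - 58 * (1 + X) ^ 9 * X ^ 9 + 183 * (1 + X) ^ 8 * X ^
        10 - 141 * (1 + X) ^ 7 * X ^ 11 + 18 * (1 + X) ^ 6 * X ^ 12 + 60 * (1 + X) ^ 5 * X ^ 13 - 47 *
        (1 + X) ^ 4 * X ^ 14 + 10 * (1 + X) ^ 3 * X ^ 15 + 6 * (1 + X) ^ 2 * X ^ 16 - 4 * (1 + X) * X
        ^ 17) =
      algebraMap (PowerSeries ℤ) SeriesField X ^ 18 * mckayDen seriesPoint := by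
    simp only [map_add, map_mul, map_sub, map_pow, map_one, map_ofNat, mckayDen, seriesPoint]
    field_simp
  rw [h0, mul_zero, map_eq_zero_iff _ algebraMap_series_injective] at h
  simpa using congrArg constantCoeff h

lemma geodesicGrowthSeries_family_eq (h₁ : (familyOne τ r).CliqueFree 3)
    (h₂ : (familyTwo τ r).CliqueFree 3) :
    geodesicGrowthSeries (familyOne τ r) = geodesicGrowthSeries (familyTwo τ r) :=
  (hasResponse_mckayT1 seriesPoint).geodesicGrowthSeries_coalescence_eq
    (hasResponse_mckayT2 seriesPoint) mckayDen_seriesPoint_ne_zero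
    (by simp [adjSum_mckayT1, adjSum_mckayT2, mckayNeighborsOne, mckayNeighborsTwo]) h₁ h₂

end GrowthEquality

end GeodesicGrowth

end

noncomputable section

namespace GeodesicGrowth

/-! ### Cospectrality -/

section Cospectral

open Matrix

/-- `P` need not be invertible over `ℤ`: its nonzero determinant can be cancelled in the domain
`ℤ[X]`. -/
lemma charpoly_eq_of_mul_eq_mul {n : Type*} [Fintype n] [DecidableEq n] {P A B : Matrix n n ℤ}
    (hP : P.det ≠ 0) (h : P * A = B * P) : A.charpoly = B.charpoly := by
  have hc : P.map Polynomial.C * A.charmatrix = B.charmatrix * P.map Polynomial.C := by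
    simp only [charmatrix, mul_sub, sub_mul, RingHom.mapMatrix_apply, ← Matrix.map_mul, h]
    congr 1
    exact (scalar_commute _ (Commute.all _) _).symm
  have hd := congrArg det hc
  rw [det_mul, det_mul, mul_comm] at hd
  refine mul_right_cancel₀ ?_ hd
  rw [← RingHom.mapMatrix_apply, ← RingHom.map_det]
  simpa using hP

open Classical in
lemma adjMatrix_coalescence {V W : Type*} (τ : SimpleGraph V) (r : V) (σ : SimpleGraph W) (s : W) :
    (coalescence τ r σ s).adjMatrix ℤ = fromBlocks (τ.adjMatrix ℤ)
      (of fun (a : V) (w : {w : W // w ≠ s}) => if a = r then σ.adjMatrix ℤ s w else 0)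
      (of fun (w : {w : W // w ≠ s}) (a : V) => if a = r then σ.adjMatrix ℤ w s else 0)
      ((σ.adjMatrix ℤ).submatrix (↑) (↑)) := by
  ext (a | a) (b | b)
  · rfl
  · have h : (coalescence τ r σ s).Adj (.inl a) (.inr b) ↔ a = r ∧ σ.Adj s b := Iff.rfl
    rw [fromBlocks_apply₁₂, of_apply, SimpleGraph.adjMatrix_apply, SimpleGraph.adjMatrix_apply,
      if_congr h rfl rfl, ite_and]
  · have h : (coalescence τ r σ s).Adj (.inr a) (.inl b) ↔ b = r ∧ σ.Adj a s :=
      and_congr_right fun _ => σ.adj_comm _ _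
    rw [fromBlocks_apply₂₁, of_apply, SimpleGraph.adjMatrix_apply, SimpleGraph.adjMatrix_apply,
      if_congr h rfl rfl, ite_and]
  · rfl

variable {V W : Type*} [Fintype V] [Fintype W] [DecidableEq W]

lemma sum_ne_mul (M N : Matrix W W ℤ) (s a b : W) :
    ∑ x : {w : W // w ≠ s}, M a x * N x b = (M * N) a b - M a s * N s b := by
  rw [mul_apply, Fintype.sum_eq_add_sum_subtype_ne _ s]
  ring

/-- A multiple of an orthogonal matrix that fixes the root and the all-one vector and intertwines
the adjacency matrices of two graphs. -/
structure IsRootedIntertwiner (σ₁ σ₂ : SimpleGraph W) (s : W) (k : ℤ) (Q : Matrix W W ℤ) : Prop where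
  ne_zero : k ≠ 0
  root_row : ∀ w, Q s w = if w = s then k else 0
  root_col : ∀ w, Q w s = if w = s then k else 0
  row_sum : ∀ w, ∑ x, Q w x = k
  col_sum : ∀ w, ∑ x, Q x w = k
  mul_transpose : Q * Qᵀ = diagonal fun _ => k ^ 2
  intertwines : ∀ [DecidableRel σ₁.Adj] [DecidableRel σ₂.Adj],
    Q * σ₁.adjMatrix ℤ = σ₂.adjMatrix ℤ * Q

/-! ### Extending an intertwiner to the coalescences -/

namespace IsRootedIntertwiner

variable {σ₁ σ₂ : SimpleGraph W} {s : W} {k : ℤ} {Q : Matrix W W ℤ}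
  (τ : SimpleGraph V) (r : V)

open Classical in
/-- The extension of an intertwiner to the coalescences with a rooted graph. -/
def extend (V : Type*) (s : W) (k : ℤ) (Q : Matrix W W ℤ) :
    Matrix (V ⊕ {w : W // w ≠ s}) (V ⊕ {w : W // w ≠ s}) ℤ :=
  fromBlocks (diagonal fun _ => k) 0 0 (Q.submatrix (↑) (↑))

-- Row and column `s` of `Q` are `k` times those of the identity, so deleting the root loses nothing
-- from the products. The entries between `τ` and `σ` agree because `Q` acts on the root as the
-- scalar `k`, just as the extension acts on `τ`.
open Classical in
lemma extend_mul_adjMatrix (hQ : IsRootedIntertwiner σ₁ σ₂ s k Q) :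
    extend V s k Q * (coalescence τ r σ₁ s).adjMatrix ℤ =
      (coalescence τ r σ₂ s).adjMatrix ℤ * extend V s k Q := by
  rw [adjMatrix_coalescence, adjMatrix_coalescence, extend, fromBlocks_multiply,
    fromBlocks_multiply]
  simp only [Matrix.mul_zero, Matrix.zero_mul, add_zero, zero_add]
  have hi := hQ.intertwines
  have hi' : ∀ a b, (Q * σ₁.adjMatrix ℤ) a b = (σ₂.adjMatrix ℤ * Q) a b := fun a b => by rw [hi]
  congr 1
  · ext a b
    rw [diagonal_mul, mul_diagonal, mul_comm]
  · ext a w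
    rw [diagonal_mul, mul_apply]
    simp only [of_apply, submatrix_apply]
    by_cases ha : a = r
    · simp only [ha, if_true]
      rw [sum_ne_mul, hQ.root_row, if_neg w.2, mul_zero, sub_zero, ← hi', mul_apply,
        Finset.sum_eq_single s (fun x _ hx => by rw [hQ.root_row, if_neg hx, zero_mul]) (by simp),
        hQ.root_row, if_pos rfl]
    · simp [ha]
  · ext w a
    rw [mul_diagonal, mul_apply]
    simp only [of_apply, submatrix_apply]
    by_cases ha : a = r
    · simp only [ha, if_true]
      rw [sum_ne_mul, hQ.root_col, if_neg w.2, zero_mul, sub_zero, hi', mul_apply,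
        Finset.sum_eq_single s (fun x _ hx => by rw [hQ.root_col, if_neg hx, mul_zero]) (by simp),
        hQ.root_col, if_pos rfl]
    · simp [ha]
  · ext w w'
    rw [mul_apply, mul_apply]
    simp only [submatrix_apply]
    rw [sum_ne_mul, sum_ne_mul, hi', hQ.root_col, if_neg w.2, hQ.root_row, if_neg w'.2]
    ring

lemma extend_mul_one_matrix (hQ : IsRootedIntertwiner σ₁ σ₂ s k Q) :
    extend V s k Q * of (fun _ _ => (1 : ℤ)) = of (fun _ _ => (1 : ℤ)) * extend V s k Q := by
  classical
  have hrow : ∀ w : {w : W // w ≠ s}, ∑ x : {w : W // w ≠ s}, Q w x = k := fun w => by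
    have := hQ.row_sum w
    rwa [Fintype.sum_eq_add_sum_subtype_ne _ s, hQ.root_col, if_neg w.2, zero_add] at this
  have hcol : ∀ w : {w : W // w ≠ s}, ∑ x : {w : W // w ≠ s}, Q x w = k := fun w => by
    have := hQ.col_sum w
    rwa [Fintype.sum_eq_add_sum_subtype_ne _ s, hQ.root_row, if_neg w.2, zero_add] at this
  have h1 : ∀ x, ∑ y, extend V s k Q x y = k := by
    rintro (a | w)
    · simp [extend, diagonal_apply]
    · simpa [extend] using hrow w
  have h2 : ∀ y, ∑ x, extend V s k Q x y = k := by
    rintro (a | w)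
    · simp [extend, diagonal_apply]
    · simpa [extend] using hcol w
  ext x y
  simp [mul_apply, h1, h2]

open Classical in
lemma det_extend_ne_zero (hQ : IsRootedIntertwiner σ₁ σ₂ s k Q) :
    (extend V s k Q).det ≠ 0 := by
  have hk := hQ.ne_zero
  rw [extend, det_fromBlocks_zero₁₂]
  refine mul_ne_zero (by simp [hk]) fun h0 => ?_
  have hm : Q.submatrix ((↑) : {w : W // w ≠ s} → W) (↑) *
      (Q.submatrix ((↑) : {w : W // w ≠ s} → W) (↑))ᵀ = diagonal fun _ => k ^ 2 := by
    ext w w'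
    have h1 := sum_ne_mul Q Qᵀ s w w'
    rw [hQ.mul_transpose, hQ.root_col, if_neg w.2, zero_mul, sub_zero] at h1
    rw [mul_apply]
    refine Eq.trans ?_ (h1.trans ?_)
    · rfl
    · simp [diagonal_apply, Subtype.ext_iff]
  have := congrArg det hm
  rw [det_mul, det_transpose, h0] at this
  rw [zero_mul, det_diagonal, eq_comm, Finset.prod_eq_zero_iff] at this
  simp [hk] at this

lemma cospectral (hQ : IsRootedIntertwiner σ₁ σ₂ s k Q) :
    Cospectral (coalescence τ r σ₁ s) (coalescence τ r σ₂ s) := by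
  classical
  have h := charpoly_eq_of_mul_eq_mul hQ.det_extend_ne_zero (hQ.extend_mul_adjMatrix τ r)
  unfold Cospectral
  convert h

lemma cospectral_compl (hQ : IsRootedIntertwiner σ₁ σ₂ s k Q) :
    Cospectral (coalescence τ r σ₁ s)ᶜ (coalescence τ r σ₂ s)ᶜ := by
  classical
  have hc : ∀ G : SimpleGraph (V ⊕ {w : W // w ≠ s}),
      Gᶜ.adjMatrix ℤ = of (fun _ _ => 1) - 1 - G.adjMatrix ℤ := by
    intro G
    ext x y
    by_cases hxy : x = y <;> by_cases h : G.Adj x y <;> simp_all [one_apply]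
  have hi : extend V s k Q * (coalescence τ r σ₁ s)ᶜ.adjMatrix ℤ =
      (coalescence τ r σ₂ s)ᶜ.adjMatrix ℤ * extend V s k Q := by
    rw [hc, hc, mul_sub, sub_mul, mul_sub, sub_mul, hQ.extend_mul_adjMatrix τ r,
      hQ.extend_mul_one_matrix, mul_one, one_mul]
  have h := charpoly_eq_of_mul_eq_mul hQ.det_extend_ne_zero hi
  unfold Cospectral
  convert h

end IsRootedIntertwiner

/-- An intertwiner for McKay's trees. -/
def mckayIntertwiner : Matrix (Fin 16) (Fin 16) ℤ :=
  !![22, 0, 0, 0, 0, 0, 0, 0, 0, 0, 0, 0, 0, 0, 0, 0;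
    0, 14, 8, 2, 2, -4, -4, -4, -6, 0, -4, 4, 8, -2, 4, 4;
    0, 8, 14, -2, -2, 4, 4, 4, 6, 0, 4, -4, -8, 2, -4, -4;
    0, 4, -4, 10, 10, 2, 2, 2, -8, 0, 2, -2, -4, 12, -2, -2;
    0, 1, -1, 8, 8, 6, -5, -5, 9, 0, 6, -6, -1, -8, 5, 5;
    0, -5, 5, 4, 4, 14, 3, 3, -1, 0, -8, 8, 5, -4, -3, -3;
    0, 3, -3, 2, 2, -4, 7, 7, 5, 0, -4, 4, -3, -2, 15, -7;
    0, 3, -3, 2, 2, -4, 7, 7, 5, 0, -4, 4, -3, -2, -7, 15;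
    0, 8, -8, -2, -2, 4, 4, 4, 6, 0, 4, -4, 14, 2, -4, -4;
    0, 0, 0, 0, 0, 0, 0, 0, 0, 22, 0, 0, 0, 0, 0, 0;
    0, -5, 5, 4, 4, -8, 3, 3, -1, 0, 14, 8, 5, -4, -3, -3;
    0, 5, -5, -4, -4, 8, -3, -3, 1, 0, 8, 14, -5, 4, 3, 3;
    0, -4, 4, 1, 1, -2, -13, 9, 8, 0, -2, 2, 4, 10, 2, 2;
    0, -4, 4, 1, 1, -2, 9, -13, 8, 0, -2, 2, 4, 10, 2, 2;
    0, -3, 3, -13, 9, 4, 4, 4, -5, 0, 4, -4, 3, 2, 7, 7;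
    0, -3, 3, 9, -13, 4, 4, 4, -5, 0, 4, -4, 3, 2, 7, 7]

/-- The factor `22` clears the denominators of a rational orthogonal matrix; the conditions are then
finite integer computations. -/
lemma isRootedIntertwiner_mckay :
    IsRootedIntertwiner mckayT1 mckayT2 0 22 mckayIntertwiner where
  ne_zero := by decide
  root_row := by decide +kernel
  root_col := by decide +kernel
  row_sum := by decide +kernel
  col_sum := by decide +kernel
  mul_transpose := by decide +kernel
  intertwines := by
    intro _ _
    have h : ∀ a b, ∑ x, mckayIntertwiner a x * (if b ∈ mckayNeighborsOne x then 1 else 0) =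
        ∑ x, (if x ∈ mckayNeighborsTwo a then 1 else 0) * mckayIntertwiner x b := by
      decide +kernel
    ext a b
    simp only [mul_apply, SimpleGraph.adjMatrix_apply, mckayT1_adj_iff, mckayT2_adj_iff]
    exact h a b

end Cospectral

end GeodesicGrowth

end

noncomputable section

namespace GeodesicGrowth

/-! ### Coalescences of trees -/

section Trees

variable {V W : Type*} {τ : SimpleGraph V} {r : V} {σ : SimpleGraph W} {s : W}

lemma coalescenceInr_of_ne {w : W} (h : w ≠ s) : coalescenceInr r s w = .inr ⟨w, h⟩ := by
  simp [coalescenceInr, h]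

lemma coalescenceInr_injective : Function.Injective (coalescenceInr r s) := by
  intro w w' h
  by_cases hw : w = s <;> by_cases hw' : w' = s <;> simp_all [coalescenceInr]

lemma coalescence_adj_coalescenceInr {w w' : W} (h : σ.Adj w w') :
    (coalescence τ r σ s).Adj (coalescenceInr r s w) (coalescenceInr r s w') := by
  by_cases hw : w = s
  · subst hw
    rw [coalescenceInr_root, coalescenceInr_of_ne h.ne']
    exact ⟨rfl, h⟩
  · rw [coalescenceInr_of_ne hw]
    by_cases hw' : w' = s
    · subst hw'
      rw [coalescenceInr_root]
      exact ⟨rfl, h.symm⟩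
    · rw [coalescenceInr_of_ne hw']
      exact h

lemma coalescence_connected (hτ : τ.Connected) (hσ : σ.Connected) :
    (coalescence τ r σ s).Connected := by
  let f : τ →g coalescence τ r σ s := ⟨Sum.inl, fun h => h⟩
  let g : σ →g coalescence τ r σ s := ⟨coalescenceInr r s, coalescence_adj_coalescenceInr⟩
  have h : ∀ x, (coalescence τ r σ s).Reachable x (.inl r) := by
    rintro (a | w)
    · exact (hτ.preconnected a r).map f
    · have := (hσ.preconnected w.1 s).map g
      simpa [g] using this
  have : Nonempty (V ⊕ {w : W // w ≠ s}) := ⟨.inl r⟩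
  exact ⟨fun x y => (h x).trans (h y).symm⟩

lemma edgeSet_coalescence : (coalescence τ r σ s).edgeSet =
    Sym2.map Sum.inl '' τ.edgeSet ∪ Sym2.map (coalescenceInr r s) '' σ.edgeSet := by
  ext e
  constructor
  · induction e with | h x y =>
    intro h
    rcases x with a | w <;> rcases y with b | w'
    · exact Or.inl ⟨s(a, b), h, rfl⟩
    · obtain ⟨rfl, h⟩ := h
      exact Or.inr ⟨s(s, w'), h, by simp⟩
    · obtain ⟨rfl, h⟩ := h
      exact Or.inr ⟨s(w.1, s), h.symm, by simp⟩
    · exact Or.inr ⟨s(w.1, w'.1), h, by simp⟩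
  · rintro (⟨e, he, rfl⟩ | ⟨e, he, rfl⟩)
    · induction e with | h x y => exact he
    · induction e with | h x y => exact coalescence_adj_coalescenceInr he

lemma card_edgeSet_coalescence [Finite V] [Finite W] :
    Nat.card (coalescence τ r σ s).edgeSet = Nat.card τ.edgeSet + Nat.card σ.edgeSet := by
  rw [Nat.card_coe_set_eq, edgeSet_coalescence, Set.ncard_union_eq ?_ (Set.toFinite _)
    (Set.toFinite _), Set.ncard_image_of_injective _ (Sym2.map.injective Sum.inl_injective),
    Set.ncard_image_of_injective _ (Sym2.map.injective coalescenceInr_injective),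
    Nat.card_coe_set_eq, Nat.card_coe_set_eq]
  rw [Set.disjoint_left]
  rintro _ ⟨e, he, rfl⟩ ⟨e', he', h⟩
  -- An edge in both images would have both ends at the merged root, hence be a loop.
  have hroot : ∀ w, w ∈ e' → w = s := by
    intro w hw
    by_contra hne
    have : coalescenceInr r s w ∈ Sym2.map Sum.inl e := by
      rw [← h]
      exact Sym2.mem_map.2 ⟨w, hw, rfl⟩
    rw [coalescenceInr_of_ne hne] at this
    obtain ⟨a, -, ha⟩ := Sym2.mem_map.1 this
    cases ha
  induction e' with | h x y =>
  have hx := hroot x (by simp)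
  have hy := hroot y (by simp)
  exact SimpleGraph.Adj.ne he' (hx.trans hy.symm)

theorem isTree_coalescence [Finite V] [Finite W] (hτ : τ.IsTree) (hσ : σ.IsTree) :
    (coalescence τ r σ s).IsTree := by
  classical
  have := Fintype.ofFinite W
  rw [SimpleGraph.isTree_iff_connected_and_card] at hτ hσ ⊢
  refine ⟨coalescence_connected hτ.1 hσ.1, ?_⟩
  have h1 : Nat.card {w : W // w ≠ s} + 1 = Nat.card W := by
    have := Fintype.card_subtype_compl (fun w => w = s)
    have hp : 0 < Fintype.card W := Fintype.card_pos_iff.2 ⟨s⟩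
    rw [Nat.card_eq_fintype_card, Nat.card_eq_fintype_card]
    simp at this ⊢
    omega
  rw [card_edgeSet_coalescence, Nat.card_sum]
  omega

/-- A graph on `Fin n` in which every vertex but `0` has exactly one smaller neighbour. -/
lemma isTree_of_parent {n : ℕ} {G : SimpleGraph (Fin (n + 1))} (p : Fin n → Fin (n + 1))
    (hp : ∀ i, p i < i.succ) (hG : ∀ a b, a < b → (G.Adj a b ↔ ∃ i, b = i.succ ∧ a = p i)) :
    G.IsTree := by
  rw [SimpleGraph.isTree_iff_connected_and_card]
  have hreach : ∀ m : ℕ, ∀ v : Fin (n + 1), v.1 ≤ m → G.Reachable v 0 := by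
    intro m
    induction m with
    | zero =>
      intro v hv
      have : v = 0 := Fin.ext (by simpa using hv)
      rw [this]
    | succ m ih =>
      intro v hv
      induction v using Fin.cases with
      | zero => exact SimpleGraph.Reachable.refl _
      | succ i =>
        have ha : G.Adj (p i) i.succ := (hG _ _ (hp i)).2 ⟨i, rfl, rfl⟩
        refine ha.symm.reachable.trans (ih _ ?_)
        have := Fin.lt_def.1 (hp i)
        omega
  refine ⟨⟨fun x y => (hreach _ x le_rfl).trans (hreach _ y le_rfl).symm⟩, ?_⟩
  have he : G.edgeSet = Set.range fun i : Fin n => s(p i, i.succ) := by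
    ext e
    induction e with | h x y =>
    constructor
    · intro h
      rcases lt_or_gt_of_ne (SimpleGraph.Adj.ne h) with hxy | hxy
      · obtain ⟨i, rfl, rfl⟩ := (hG _ _ hxy).1 h
        exact ⟨i, rfl⟩
      · obtain ⟨i, rfl, rfl⟩ := (hG _ _ hxy).1 h.symm
        exact ⟨i, Sym2.eq_swap⟩
    · rintro ⟨i, hi⟩
      rw [← hi]
      exact (hG _ _ (hp i)).2 ⟨i, rfl, rfl⟩
  have hinj : Function.Injective fun i : Fin n => s(p i, i.succ) := by
    intro i j hij
    rcases Sym2.eq_iff.1 hij with ⟨-, h⟩ | ⟨h1, h2⟩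
    · exact Fin.succ_injective n h
    · have hi := hp i
      have hj := hp j
      rw [h1] at hi
      rw [← h2] at hj
      exact absurd hi hj.asymm
  rw [he, Nat.card_range_of_injective hinj]
  simp

lemma isTree_mckayT1 : mckayT1.IsTree := by
  refine isTree_of_parent ![0, 0, 1, 1, 2, 3, 4, 5, 5, 8, 9, 10, 11, 13, 13] (by decide) ?_
  simp only [mckayT1_adj_iff]
  decide +kernel

lemma isTree_mckayT2 : mckayT2.IsTree := by
  refine isTree_of_parent ![0, 0, 1, 2, 2, 3, 3, 4, 5, 8, 9, 11, 11, 12, 13] (by decide) ?_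
  simp only [mckayT2_adj_iff]
  decide +kernel

end Trees

end GeodesicGrowth

end

noncomputable section

namespace GeodesicGrowth

/-! ### Non-isomorphism of the coalescences -/

section Fork

variable {V W : Type*} [Fintype V] [Fintype W]

/-- The degree of a vertex, as an integer. -/
def intDegree (G : SimpleGraph V) (v : V) : ℤ := adjSum G (fun _ => 1) v

lemma intDegree_iso {G : SimpleGraph V} {H : SimpleGraph W} (φ : G ≃g H) (v : V) :
    intDegree H (φ v) = intDegree G v := by
  classical
  rw [intDegree, intDegree, adjSum, adjSum, ← φ.toEquiv.sum_comp]
  refine Finset.sum_congr rfl fun a _ => ?_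
  by_cases h : G.Adj v a
  · exact (if_pos (φ.map_adj_iff.2 h)).trans (if_pos h).symm
  · exact (if_neg (mt φ.map_adj_iff.1 h)).trans (if_neg h).symm

lemma intDegree_pos {G : SimpleGraph V} {v a : V} (h : G.Adj v a) : 1 ≤ intDegree G v := by
  classical
  have h0 : ∀ x ∈ Finset.univ, (0 : ℤ) ≤ if G.Adj v x then 1 else 0 := by
    intro x _
    split_ifs <;> simp
  have h1 := Finset.single_le_sum h0 (Finset.mem_univ a)
  rw [if_pos h] at h1
  exact h1

/-- All neighbours of `v` have degree `2`, and one of them is adjacent to a leaf other than `v`. -/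
def IsFork (G : SimpleGraph V) (v : V) : Prop :=
  (∀ x, G.Adj v x → intDegree G x = 2) ∧
    ∃ x y, G.Adj v x ∧ G.Adj x y ∧ y ≠ v ∧ intDegree G y = 1

lemma isFork_of_iso {G : SimpleGraph V} {H : SimpleGraph W} (φ : G ≃g H) {v : V}
    (h : IsFork G v) : IsFork H (φ v) := by
  obtain ⟨h1, x, y, hx, hy, hne, hd⟩ := h
  refine ⟨fun z hz => ?_, φ x, φ y, φ.map_adj_iff.2 hx, φ.map_adj_iff.2 hy,
    fun he => hne (φ.injective he), by rw [intDegree_iso, hd]⟩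
  obtain ⟨z, rfl⟩ := φ.surjective z
  rw [intDegree_iso]
  exact h1 z (φ.map_adj_iff.1 hz)

lemma ncard_isFork_le_of_iso {G : SimpleGraph V} {H : SimpleGraph W} (φ : G ≃g H) :
    {v | IsFork H v}.ncard ≤ {v | IsFork G v}.ncard :=
  Set.ncard_le_ncard_of_injOn φ.symm (fun _ hv => isFork_of_iso φ.symm hv)
    φ.symm.injective.injOn (Set.toFinite _)

variable [DecidableEq W] {τ : SimpleGraph V} {r : V} {σ : SimpleGraph W} {s : W}

lemma intDegree_coalescence_inr (w : {w : W // w ≠ s}) :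
    intDegree (coalescence τ r σ s) (.inr w) = intDegree σ w :=
  adjSum_coalescence_inr τ r σ s (fun _ => 1) w

open Classical in
lemma intDegree_coalescence_inl (a : V) :
    intDegree (coalescence τ r σ s) (.inl a) =
      intDegree τ a + if a = r then intDegree σ s else 0 :=
  adjSum_coalescence_inl τ r σ s (fun _ => 1) a

lemma intDegree_coalescence_root (hs : intDegree σ s = 2) (hr : 1 ≤ intDegree τ r) :
    3 ≤ intDegree (coalescence τ r σ s) (.inl r) := by
  rw [intDegree_coalescence_inl, if_pos rfl, hs]
  omega

/-- The merged root has degree at least `3`. So it is neither an allowed neighbour of a fork nor a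
leaf, and forks strictly inside `σ` do not see `τ`. -/
lemma isFork_coalescence_inr (hs : intDegree σ s = 2) (hr : 1 ≤ intDegree τ r)
    (w : {w : W // w ≠ s}) :
    IsFork (coalescence τ r σ s) (.inr w) ↔ ¬ σ.Adj s w ∧ IsFork σ w := by
  have h3 := intDegree_coalescence_root hs hr
  constructor
  · rintro ⟨h1, x, y, hx, hy, hne, hd⟩
    have hn : ¬ σ.Adj s w := fun h => by
      have := h1 (.inl r) ⟨rfl, h⟩
      omega
    have hn' : ∀ {x}, σ.Adj w x → x ≠ s := fun hx he => hn (he ▸ hx.symm)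
    refine ⟨hn, fun x hx => ?_, ?_⟩
    · have := h1 (.inr ⟨x, hn' hx⟩) hx
      rwa [intDegree_coalescence_inr] at this
    · rcases x with a | x
      · exact absurd hx.2 hn
      · rcases y with a | y
        · obtain ⟨rfl, -⟩ := hy
          omega
        · rw [intDegree_coalescence_inr] at hd
          exact ⟨x, y, hx, hy, fun he => hne (congrArg Sum.inr (Subtype.ext he)), hd⟩
  · rintro ⟨hn, h1, x, y, hx, hy, hne, hd⟩
    have hn' : ∀ {x}, σ.Adj w x → x ≠ s := fun hx he => hn (he ▸ hx.symm)
    refine ⟨fun z hz => ?_, ?_⟩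
    · rcases z with a | z
      · exact absurd hz.2 hn
      · rw [intDegree_coalescence_inr]
        exact h1 z hz
    · have hys : y ≠ s := by
        rintro rfl
        omega
      refine ⟨.inr ⟨x, hn' hx⟩, .inr ⟨y, hys⟩, hx, hy, fun he => hne ?_, ?_⟩
      · exact congrArg Subtype.val (Sum.inr.inj he)
      · rwa [intDegree_coalescence_inr]

lemma not_isFork_coalescence_root {w : W} (hw : σ.Adj s w) (hd : intDegree σ w ≠ 2) :
    ¬ IsFork (coalescence τ r σ s) (.inl r) := by
  rintro ⟨h1, -⟩
  have := h1 (.inr ⟨w, hw.ne'⟩) ⟨rfl, hw⟩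
  rw [intDegree_coalescence_inr] at this
  exact hd this

/-- The condition at `a ≠ r` involves `σ` only through the root degree: a witnessing leaf inside `σ`
would be reached through the root, which has degree at least `3` rather than `2`. -/
lemma isFork_coalescence_inl_of_isFork {σ' : SimpleGraph W} (hs : intDegree σ s = 2)
    (hs' : intDegree σ' s = 2) (hr : 1 ≤ intDegree τ r) {a : V} (ha : a ≠ r)
    (h : IsFork (coalescence τ r σ s) (.inl a)) : IsFork (coalescence τ r σ' s) (.inl a) := by
  have h3 := intDegree_coalescence_root hs hr
  have hd : ∀ b, intDegree (coalescence τ r σ' s) (.inl b) =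
      intDegree (coalescence τ r σ s) (.inl b) := by
    intro b
    rw [intDegree_coalescence_inl, intDegree_coalescence_inl, hs, hs']
  obtain ⟨h1, x, y, hx, hy, hne, hy1⟩ := h
  refine ⟨fun z hz => ?_, ?_⟩
  · rcases z with b | w
    · rw [hd]
      exact h1 (.inl b) hz
    · exact absurd hz.1 ha
  · rcases x with b | w
    · rcases y with c | w
      · exact ⟨.inl b, .inl c, hx, hy, hne, by rwa [hd]⟩
      · obtain ⟨rfl, -⟩ := hy
        have := h1 _ hx
        omega
    · exact absurd hx.1 ha

end Fork

/-! ### Forks in McKay's trees -/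

section McKayFork

lemma intDegree_mckayT1 (w : Fin 16) : intDegree mckayT1 w = (mckayNeighborsOne w).card := by
  simp [intDegree, adjSum_mckayT1]

lemma intDegree_mckayT2 (w : Fin 16) : intDegree mckayT2 w = (mckayNeighborsTwo w).card := by
  simp [intDegree, adjSum_mckayT2]

/-- Neighbours of the root must be excluded: vertex `1` is a fork of `mckayT1`, and only the
coalescence with a nontrivial `τ` destroys it. -/
lemma not_isFork_mckayT1 : ∀ w, ¬ mckayT1.Adj 0 w → ¬ IsFork mckayT1 w := by
  simp only [IsFork, intDegree_mckayT1, mckayT1_adj_iff]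
  decide +kernel

lemma isFork_mckayT2 : ¬ mckayT2.Adj 0 11 ∧ IsFork mckayT2 11 := by
  simp only [IsFork, intDegree_mckayT2, mckayT2_adj_iff]
  decide +kernel

/-- A neighbour of `r` in `τ` is essential: without their roots the two trees are isomorphic, the
root of the second corresponding to vertex `9` of the first. -/
theorem not_nonempty_iso_family {V : Type*} [Fintype V] {τ : SimpleGraph V} {r a : V}
    (hr : τ.Adj r a) : ¬ Nonempty (familyOne τ r ≃g familyTwo τ r) := by
  rintro ⟨φ⟩
  have hr' := intDegree_pos hr
  have hs₁ : intDegree mckayT1 0 = 2 := by rw [intDegree_mckayT1]; decide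
  have hs₂ : intDegree mckayT2 0 = 2 := by rw [intDegree_mckayT2]; decide
  -- Both families live on the same vertex type, so the sets of forks can be compared directly;
  -- vertex `11` of `mckayT2` makes the inclusion strict.
  have hlt : {v | IsFork (familyOne τ r) v} ⊂ {v | IsFork (familyTwo τ r) v} := by
    rw [Set.ssubset_iff_of_subset]
    · refine ⟨.inr ⟨11, by decide⟩, ?_, ?_⟩
      · exact (isFork_coalescence_inr hs₂ hr' _).2 isFork_mckayT2
      · intro h
        have h' := (isFork_coalescence_inr hs₁ hr' _).1 h
        exact not_isFork_mckayT1 _ h'.1 h'.2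
    · rintro (b | w) h
      · refine isFork_coalescence_inl_of_isFork hs₁ hs₂ hr' ?_ h
        rintro rfl
        refine not_isFork_coalescence_root (w := 1) ?_ ?_ h
        · rw [mckayT1_adj_iff]; decide
        · rw [intDegree_mckayT1]; decide
      · have h' := (isFork_coalescence_inr hs₁ hr' w).1 h
        exact absurd h'.2 (not_isFork_mckayT1 _ h'.1)
  exact absurd (Set.ncard_lt_ncard hlt (Set.toFinite _)) (ncard_isFork_le_of_iso φ).not_gt

end McKayFork

end GeodesicGrowth

end

/-- For every `n ≥ 17` the two families `τ · T₁` and `τ · T₂` are indexed by the rooted trees `(τ, r)`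
on `n - 15` vertices; the first conjunct says that there are such. -/
theorem theorem1 (n : ℕ) (hn : 17 ≤ n) :
    (∃ τ : SimpleGraph (Fin (n - 15)), τ.IsTree) ∧
    ∀ (V : Type*) [Fintype V] (τ : SimpleGraph V) (r : V),
      τ.IsTree → Fintype.card V + 15 = n →
      Fintype.card (V ⊕ {w : Fin 16 // w ≠ 0}) = n ∧
      (GeodesicGrowth.familyOne τ r).IsTree ∧
      (GeodesicGrowth.familyTwo τ r).IsTree ∧
      ¬ Nonempty (GeodesicGrowth.familyOne τ r ≃g GeodesicGrowth.familyTwo τ r) ∧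
      GeodesicGrowth.Cospectral (GeodesicGrowth.familyOne τ r) (GeodesicGrowth.familyTwo τ r) ∧
      GeodesicGrowth.Cospectral (GeodesicGrowth.familyOne τ r)ᶜ (GeodesicGrowth.familyTwo τ r)ᶜ ∧
      GeodesicGrowth.geodesicGrowthSeries (GeodesicGrowth.familyOne τ r) =
        GeodesicGrowth.geodesicGrowthSeries (GeodesicGrowth.familyTwo τ r) := by
  open GeodesicGrowth in
  refine ⟨?_, fun V _ τ r hτ hcard => ?_⟩
  · have : Nonempty (Fin (n - 15)) := ⟨⟨0, by omega⟩⟩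
    obtain ⟨T, -, hT⟩ := (SimpleGraph.connected_top (V := Fin (n - 15))).exists_isTree_le
    exact ⟨T, hT⟩
  -- This is where `n ≥ 17` enters: `τ` has at least two vertices, so its root has a neighbour.
  · have : Nontrivial V := Fintype.one_lt_card_iff_nontrivial.1 (by omega)
    obtain ⟨a, ha⟩ := hτ.connected.preconnected.exists_adj_of_nontrivial r
    have h₁ : (familyOne τ r).IsTree := isTree_coalescence hτ isTree_mckayT1
    have h₂ : (familyTwo τ r).IsTree := isTree_coalescence hτ isTree_mckayT2
    refine ⟨?_, h₁, h₂, not_nonempty_iso_family ha, isRootedIntertwiner_mckay.cospectral τ r,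
      isRootedIntertwiner_mckay.cospectral_compl τ r,
      geodesicGrowthSeries_family_eq (h₁.isAcyclic.cliqueFree le_rfl)
        (h₂.isAcyclic.cliqueFree le_rfl)⟩
    rw [Fintype.card_sum]
    simpa using hcard
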